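/- Let $\mathbb{A}$ be a finite alphabet and let $w_1$ be a finite word over $\mathbb{A}$ containing two different letters. For a word $w$ and an integer $0\le a<|w|$ let $\rho_a(w)=w''w'$, where $w=w'w''$ and $|w'|=a$, be its cyclic rotation. Given integers $q_n\ge 2$ ($n\ge 1$), put $h_1=|w_1|$, $h_{n+1}=q_nh_n$, and suppose that $q_n\sim h_n^{\gamma}$ (that is, $q_n/h_n^{\gamma}\to 1$ as $n\to\infty$) for some real $\gamma\ge 1$. Let $\omega_n(j)$, $n\ge1$, $1\le j<q_n$, be independent random variables, $\omega_n(j)$ being uniformly distributed on $\{0,1,\dots,h_n-1\}$, and define random words by $$w_{n+1}=w_n\,\rho_{\omega_n(1)}(w_n)\,\rho_{\omega_n(2)}(w_n)\cdots\rho_{\omega_n(q_n-1)}(w_n),$$ so that $|w_n|=h_n$. Let $w_\infty$ be the infinite word having every $w_n$ as a prefix, and let $p_{w_\infty}(l)$ be the number of different subwords of length $l$ of $w_\infty$. Then almost surely the following holds: for every $\varepsilon>0$ there is an $n_0=n_0(\varepsilon)$ (which may depend on the realization of the random parameters) such that $$p_{w_\infty}(h_n)\ \ge\ h_n^{\,3-\varepsilon}\qquad\text{for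 all } n\ge n_0 .$$ -/

import Mathlib

open Filter Asymptotics MeasureTheory ProbabilityTheory

/-- The deterministic data of an iceberg construction without spacers: an initial word over the
alphabet `A` containing two different letters, and the numbers `q n ≥ 2` of rotated copies that are
concatenated at each step. Steps are numbered from `0`, so `init` is the word of step `0`. -/
structure IcebergScheme (A : Type*) where
  /-- the initial word -/
  init : List A
  /-- the initial word contains a pair of different letters -/
  nontrivial : ∃ a ∈ init, ∃ b ∈ init, a ≠ b
  /-- the number of rotated copies concatenated at step `n` -/
  q : ℕ → ℕ
  two_le_q : ∀ n, 2 ≤ q n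

namespace IcebergScheme

variable {A : Type*} (S : IcebergScheme A)

/-- The lengths `h n` of the words of the construction: `h (n + 1) = q n * h n`
(see `length_word`). -/
def height : ℕ → ℕ
  | 0 => S.init.length
  | n + 1 => S.q n * height n

/-- The words of the construction with rotation parameters `α n j`:
`w (n + 1) = ρ_{α n 0} (w n) ρ_{α n 1} (w n) ⋯ ρ_{α n (q n - 1)} (w n)`, where `ρ_a w` is the cyclic
rotation `w₂ w₁` of `w = w₁ w₂`, `|w₁| = a` (`List.rotate`, which reduces `a` modulo `|w|`). -/
def word (α : ℕ → ℕ → ℕ) : ℕ → List A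
  | 0 => S.init
  | n + 1 => (List.range (S.q n)).flatMap fun j => (word α n).rotate (α n j)

theorem length_word (α : ℕ → ℕ → ℕ) (n : ℕ) : (S.word α n).length = S.height n := by
  induction n with
  | zero => rfl
  | succ n ih => simp [word, height, List.length_flatMap, ih]

theorem lt_height (n : ℕ) : n < S.height n := by
  induction n with
  | zero =>
    obtain ⟨a, ha, -⟩ := S.nontrivial
    exact List.length_pos_of_mem ha
  | succ n ih =>
    have h2 := S.two_le_q n
    have : 2 * S.height n ≤ S.q n * S.height n := Nat.mul_le_mul_right _ h2
    simp only [height]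
    omega

/-- The infinite word `w_∞` of the construction: its letter number `k` is the letter number `k`
of `w k` (positions are numbered from `0`). If `α n 0 = 0` for all `n`, this is the infinite word
having every `w n` as a prefix (see `word_eq_limitWord`). -/
def limitWord (α : ℕ → ℕ → ℕ) (k : ℕ) : A :=
  (S.word α k)[k]'(by rw [S.length_word]; exact S.lt_height k)

theorem word_prefix_succ {α : ℕ → ℕ → ℕ} (h0 : ∀ n, α n 0 = 0) (n : ℕ) :
    S.word α n <+: S.word α (n + 1) := by
  obtain ⟨m, hm⟩ : ∃ m, S.q n = m + 1 := ⟨S.q n - 1, by have := S.two_le_q n; omega⟩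
  simp [word, hm, List.range_succ_eq_map, h0]

theorem word_prefix {α : ℕ → ℕ → ℕ} (h0 : ∀ n, α n 0 = 0) {m n : ℕ} (hmn : m ≤ n) :
    S.word α m <+: S.word α n := by
  induction n, hmn using Nat.le_induction with
  | base => exact List.prefix_rfl
  | succ n _ ih => exact ih.trans (S.word_prefix_succ h0 n)

/-- Every word of the construction is a prefix of the infinite word. -/
theorem word_eq_limitWord {α : ℕ → ℕ → ℕ} (h0 : ∀ n, α n 0 = 0) (n i : ℕ)
    (hi : i < (S.word α n).length) : (S.word α n)[i] = S.limitWord α i := by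
  unfold limitWord
  rcases le_total n i with h | h
  · exact (S.word_prefix h0 h).getElem hi
  · exact ((S.word_prefix h0 h).getElem _).symm

end IcebergScheme

/-- The set of subwords of length `l` of an infinite word `W`. -/
def subwords {A : Type*} (W : ℕ → A) (l : ℕ) : Set (Fin l → A) :=
  {u | ∃ i : ℕ, ∀ k : Fin l, u k = W (i + k)}

/-- The symbolic complexity of an infinite word `W` over a finite alphabet: the number of different
subwords of length `l`. -/
noncomputable def symbolicComplexity {A : Type*} (W : ℕ → A) (l : ℕ) : ℕ :=
  (subwords W l).ncard

/-! Write h for the length of the word w of step n. At a junction of two rotated copies of the word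
of step n + 1, the infinite word contains subwords of length h that read t letters of the periodic
word w up to a phase x and then h - t letters from a phase y. If the pieces meeting there are long
enough, every t between about h / 3 and 2h / 3 is available. So about h ^ 2 possible pairs (x, y)
times h / 3 cuts t give order h ^ 3, provided that almost all pairs occur up to a factor h ^ ε and
that different triples give different words.

Different triples: almost surely, for all large n, a segment of length h / 3 of the periodic word w
determines its position modulo h (`SegmentsDeterminePosition`). For fixed shifts, coincidence forces
about q / 9 independent coincidences of letters, each of probability at most 1 - 1 / `S.height 0`,
because no letter has larger frequency; a union bound over the shifts remains summable. The outer
thirds of a subword then recover x and y once t is known, and t is recovered because a seam requires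
the letters at x and y to differ (`seamWord_injOn`).

Many pairs: conditionally on the lower steps, a random junction is a seam whose phases avoid a given
set of at most h ^ 2 / (48 `S.height 0`) pairs with probability at least 1 / (48 `S.height 0`)
(`card_not_new_seam_le`). There are at least h ^ 2 / 8 - 1 disjoint, hence independent, junctions.
The event that all seams have phases in some set of K = h ^ (2 - ε) pairs therefore has probability
at most h ^ (2K) c ^ (h ^ 2 / 8 - 1) with c < 1, which is summable (`measure_card_seamPhases_le`).
Borel–Cantelli finishes both points. -/

theorem List.getElem_flatMap_range {A : Type*} (f : ℕ → List A) {h : ℕ}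
    (hf : ∀ j, (f j).length = h) (q i : ℕ) (hi : i < ((List.range q).flatMap f).length)
    (hr : i % h < (f (i / h)).length) :
    ((List.range q).flatMap f)[i] = (f (i / h))[i % h] := by
  have hh : 0 < h := by
    rw [hf] at hr
    exact Nat.pos_of_ne_zero fun h0 => by simp [h0] at hi hf; simp [hf] at hi
  have hlen : ∀ q, ((List.range q).flatMap f).length = q * h := by
    intro q; simp [List.length_flatMap, hf]
  induction q with
  | zero => simp at hi
  | succ q ih =>
    simp only [List.range_succ, List.flatMap_append, List.flatMap_singleton]
    by_cases hq : i < q * h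
    · rw [List.getElem_append_left (by rw [hlen]; exact hq)]
      exact ih _
    · rw [List.getElem_append_right (by rw [hlen]; omega)]
      have hi' : i < (q + 1) * h := by rw [← hlen]; exact hi
      have hdiv : i / h = q :=
        Nat.div_eq_of_lt_le (by omega) hi'
      have hmod : i - ((List.range q).flatMap f).length = i % h := by
        rw [hlen, Nat.mod_eq_sub_mul_div, hdiv, mul_comm]
      simp only [hdiv, hmod]

/-! ### Periodic words and letter frequencies -/

namespace IcebergScheme

variable {A : Type*} (S : IcebergScheme A)

theorem height_pos (n : ℕ) : 0 < S.height n := (Nat.zero_le n).trans_lt (S.lt_height n)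

theorem q_pos (n : ℕ) : 0 < S.q n := by have := S.two_le_q n; omega

theorem height_succ (n : ℕ) : S.height (n + 1) = S.q n * S.height n := rfl

/-- The periodic infinite word with period `S.word α n`. -/
def cyclicWord (α : ℕ → ℕ → ℕ) (n i : ℕ) : A :=
  (S.word α n)[i % S.height n]'(by rw [S.length_word]; exact Nat.mod_lt _ (S.height_pos n))

variable {S}

theorem cyclicWord_congr {α : ℕ → ℕ → ℕ} {n i j : ℕ} (h : i ≡ j [MOD S.height n]) :
    S.cyclicWord α n i = S.cyclicWord α n j := by
  have : i % S.height n = j % S.height n := h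
  simp only [cyclicWord, this]

theorem word_congr {α β : ℕ → ℕ → ℕ} {n : ℕ} (h : ∀ m < n, ∀ j < S.q m, α m j = β m j) :
    S.word α n = S.word β n := by
  induction n with
  | zero => rfl
  | succ n ih =>
    simp only [word, ih fun m hm => h m (hm.trans n.lt_succ_self)]
    refine List.flatMap_congr fun j hj => ?_
    rw [h n n.lt_succ_self j (List.mem_range.1 hj)]

theorem cyclicWord_eq_of_forall {α β : ℕ → ℕ → ℕ} {n : ℕ}
    (h : ∀ m < n, ∀ j < S.q m, α m j = β m j) : S.cyclicWord α n = S.cyclicWord β n := by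
  funext i
  simp only [cyclicWord, word_congr h]

theorem cyclicWord_succ (α : ℕ → ℕ → ℕ) (n p : ℕ) :
    S.cyclicWord α (n + 1) p =
      S.cyclicWord α n (p + α n (p / S.height n % S.q n)) := by
  have hd : p % (S.q n * S.height n) / S.height n = p / S.height n % S.q n := by
    rw [Nat.mod_mul_left_div_self]
  have hm : p % (S.q n * S.height n) % S.height n = p % S.height n :=
    Nat.mod_mul_left_mod _ _ _
  have hlen : ∀ j, ((S.word α n).rotate (α n j)).length = S.height n := by
    simp [S.length_word]
  simp only [cyclicWord, word, height]
  rw [List.getElem_flatMap_range (fun j => (S.word α n).rotate (α n j)) hlen _ _ _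
    (by rw [hlen]; exact Nat.mod_lt _ (S.height_pos n))]
  rw [List.getElem_rotate]
  simp only [hd, hm, S.length_word, Nat.mod_add_mod]

theorem limitWord_eq_cyclicWord {α : ℕ → ℕ → ℕ} (h0 : ∀ n, α n 0 = 0) {n i : ℕ}
    (hi : i < S.height n) : S.limitWord α i = S.cyclicWord α n i := by
  rw [← S.word_eq_limitWord h0 n i (by rwa [S.length_word])]
  simp only [cyclicWord, Nat.mod_eq_of_lt hi]

/-- The number of letters different from `z` in a period of the word of step `n`. -/
noncomputable def neCount (S : IcebergScheme A) (α : ℕ → ℕ → ℕ) (n : ℕ) (z : A) : ℕ :=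
  open Classical in (S.height n).count fun i => S.cyclicWord α n i ≠ z

open Classical in
theorem count_cyclicWord_add (α : ℕ → ℕ → ℕ) (n r : ℕ) (z : A) :
    (S.height n).count (fun i => S.cyclicWord α n (r + i) ≠ z) = S.neCount α n z := by
  have hp := Nat.filter_Ico_card_eq_of_periodic r (S.height n)
    (fun i => S.cyclicWord α n i ≠ z) (fun i => by
      simp only [cyclicWord_congr (show i + S.height n ≡ i [MOD S.height n] by simp)])
  rw [neCount, ← hp, Nat.count_eq_card_filter_range]
  refine Finset.card_bij (fun i _ => r + i) ?_ (fun i _ j _ h => by simpa using h) ?_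
  · intro i hi
    simp only [Finset.mem_filter, Finset.mem_Ico, Finset.mem_range] at hi ⊢
    exact ⟨by omega, hi.2⟩
  · intro j hj
    simp only [Finset.mem_filter, Finset.mem_Ico] at hj
    refine ⟨j - r, ?_, by omega⟩
    simp only [Finset.mem_filter, Finset.mem_range]
    refine ⟨by omega, ?_⟩
    rw [show r + (j - r) = j by omega]; exact hj.2

open Classical in
/-- Aligned blocks of the word of step `n + 1` have the letter counts of the word of step `n`. -/
theorem count_cyclicWord_succ (α : ℕ → ℕ → ℕ) (n B m : ℕ) (z : A) :
    (m * S.height n).count (fun i => S.cyclicWord α (n + 1) (B * S.height n + i) ≠ z) =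
      m * S.neCount α n z := by
  induction m with
  | zero => simp
  | succ m ih =>
    rw [add_mul, one_mul, Nat.count_add, ih, add_mul, one_mul, Nat.add_left_cancel_iff,
      ← count_cyclicWord_add (S := S) α n
        ((B + m) * S.height n + α n ((B + m) % S.q n)) z]
    simp only [Nat.count_eq_card_filter_range]
    congr 1
    refine Finset.filter_congr fun k hk => ?_
    rw [Finset.mem_range] at hk
    have hd : (B * S.height n + (m * S.height n + k)) / S.height n = B + m := by
      rw [← add_assoc, ← add_mul, mul_comm, Nat.mul_add_div (S.height_pos n),
        Nat.div_eq_of_lt hk, add_zero]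
    rw [cyclicWord_succ, hd]
    ring_nf

theorem neCount_succ (α : ℕ → ℕ → ℕ) (n : ℕ) (z : A) :
    S.neCount α (n + 1) z = S.q n * S.neCount α n z := by
  have := count_cyclicWord_succ (S := S) α n 0 (S.q n) z
  rw [← this, ← count_cyclicWord_add (S := S) α (n + 1) (0 * S.height n) z]
  rfl

/-- Rotations preserve letter counts, so the frequency of letters other than `z` is the same at
every step. In the initial word it is positive, hence at least 1 / `S.height 0`. This is the only
source of randomness in the letters. -/
theorem height_le_neCount (α : ℕ → ℕ → ℕ) (n : ℕ) (z : A) :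
    S.height n ≤ S.height 0 * S.neCount α n z := by
  induction n with
  | zero =>
    refine Nat.le_mul_of_pos_right _ ?_
    obtain ⟨c, hc, hcz⟩ : ∃ c ∈ S.init, c ≠ z := by
      obtain ⟨a, ha, b, hb, hab⟩ := S.nontrivial
      by_cases h : a = z
      · exact ⟨b, hb, fun h' => hab (h.trans h'.symm)⟩
      · exact ⟨a, ha, h⟩
    obtain ⟨i, hi, rfl⟩ := List.getElem_of_mem hc
    classical
    rw [neCount, Nat.count_eq_card_filter_range]
    refine Finset.card_pos.2 ⟨i, ?_⟩
    simp only [Finset.mem_filter, Finset.mem_range]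
    refine ⟨hi, ?_⟩
    have : i % S.height 0 = i := Nat.mod_eq_of_lt hi
    simpa [cyclicWord, this, word] using hcz
  | succ n ih =>
    rw [neCount_succ, height_succ]
    calc S.q n * S.height n ≤ S.q n * (S.height 0 * S.neCount α n z) := Nat.mul_le_mul_left _ ih
      _ = _ := by ring

open Classical in
/-- Every letter is avoided with positive frequency in each segment of the word of step `n + 1`
that contains `m` blocks. -/
theorem mul_neCount_le_count (α : ℕ → ℕ → ℕ) (n r m l : ℕ) (hl : (m + 1) * S.height n ≤ l)
    (z : A) : m * S.neCount α n z ≤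
      l.count (fun i => S.cyclicWord α (n + 1) (r + i) ≠ z) := by
  set B := r / S.height n + 1 with hB
  obtain ⟨e, he, heh⟩ : ∃ e, r + e = B * S.height n ∧ e ≤ S.height n := by
    have h1 := Nat.div_add_mod r (S.height n)
    have h2 := Nat.mod_lt r (S.height_pos n)
    refine ⟨S.height n - r % S.height n, ?_, by omega⟩
    rw [hB, add_mul, one_mul, mul_comm (r / S.height n)]
    omega
  rw [← count_cyclicWord_succ (S := S) α n B m z]
  have hle : e + m * S.height n ≤ l := by
    rw [add_mul, one_mul] at hl; omega
  refine le_trans ?_ (Nat.count_monotone _ hle)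
  rw [Nat.count_add]
  simp only [← he, ← add_assoc]
  exact Nat.le_add_left _ _

end IcebergScheme

/-! ### Independent uniform parameters -/

section Probability

variable {Ω : Type*} [MeasurableSpace Ω] {P : Measure Ω}

/-- Each pair in the square has probability 1 / h ^ 2 and the pairs outside it are null, so a
probability bound reduces to counting. -/
theorem measure_pair_mem_le_of_uniformOn [IsProbabilityMeasure P] {X Y : Ω → ℕ} {h : ℕ}
    (hh : 0 < h) (hX : Measurable X) (hY : Measurable Y)
    (hXu : P.map X = uniformOn (Set.Iio h)) (hYu : P.map Y = uniformOn (Set.Iio h))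
    (hXY : IndepFun X Y P) (E : Set (ℕ × ℕ)) [DecidablePred (· ∈ E)] {c : ℝ}
    (hE : (((Finset.range h ×ˢ Finset.range h).filter (· ∈ E)).card : ℝ) ≤ c * (h : ℝ) ^ 2) :
    P {x | (X x, Y x) ∈ E} ≤ ENNReal.ofReal c := by
  have hcoe : (Set.Iio h : Set ℕ) = ((Finset.range h : Finset ℕ) : Set ℕ) := by
    ext; simp
  have hpt : ∀ {Z : Ω → ℕ}, Measurable Z → P.map Z = uniformOn (Set.Iio h) → ∀ s < h,
      P (Z ⁻¹' {s}) = (h : ENNReal)⁻¹ := by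
    intro Z hZ hZu s hs
    rw [← Measure.map_apply hZ (measurableSet_singleton s), hZu, hcoe]
    have := uniformOn_apply_finset (s := Finset.range h) (t := {s})
    rw [Finset.coe_singleton] at this
    rw [this, Finset.inter_singleton_of_mem (Finset.mem_range.2 hs)]
    simp
  have hout : ∀ {Z : Ω → ℕ}, Measurable Z → P.map Z = uniformOn (Set.Iio h) →
      P (Z ⁻¹' (Set.Iio h)ᶜ) = 0 := by
    intro Z hZ hZu
    rw [← Measure.map_apply hZ (Set.to_countable _).measurableSet, hZu,
      uniformOn_eq_zero_iff (Set.finite_Iio h), Set.inter_compl_self]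
  set F := (Finset.range h ×ˢ Finset.range h).filter (· ∈ E) with hF
  have hsub : {x | (X x, Y x) ∈ E} ⊆
      (⋃ p ∈ F, X ⁻¹' {p.1} ∩ Y ⁻¹' {p.2}) ∪ (X ⁻¹' (Set.Iio h)ᶜ ∪ Y ⁻¹' (Set.Iio h)ᶜ) := by
    intro x hx
    by_cases h1 : X x < h
    · by_cases h2 : Y x < h
      · left
        simp only [Set.mem_iUnion]
        exact ⟨(X x, Y x), by simpa [hF, h1, h2] using hx, by simp⟩
      · right; right; simpa using h2
    · right; left; simpa using h1
  refine (measure_mono hsub).trans ((measure_union_le _ _).trans ?_)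
  rw [measure_union_null (hout hX hXu) (hout hY hYu), add_zero]
  have hterm : ∀ p ∈ F, P (X ⁻¹' {p.1} ∩ Y ⁻¹' {p.2}) = (h : ENNReal)⁻¹ * (h : ENNReal)⁻¹ := by
    intro p hp
    simp only [hF, Finset.mem_filter, Finset.mem_product, Finset.mem_range] at hp
    rw [hXY.measure_inter_preimage_eq_mul _ _ (measurableSet_singleton _)
      (measurableSet_singleton _), hpt hX hXu _ hp.1.1, hpt hY hYu _ hp.1.2]
  refine (measure_biUnion_finset_le _ _).trans ?_
  rw [Finset.sum_congr rfl hterm, Finset.sum_const, nsmul_eq_mul]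
  have hpos : (0 : ℝ) < h := by exact_mod_cast hh
  have hhinv : (h : ENNReal)⁻¹ = ENNReal.ofReal ((h : ℝ)⁻¹) := by
    rw [ENNReal.ofReal_inv_of_pos hpos, ENNReal.ofReal_natCast]
  rw [hhinv, ← ENNReal.ofReal_natCast, ← ENNReal.ofReal_mul (by positivity),
    ← ENNReal.ofReal_mul (by positivity)]
  refine ENNReal.ofReal_le_ofReal ?_
  rw [← mul_inv, ← div_eq_mul_inv, div_le_iff₀ (by positivity)]
  calc _ ≤ _ := hE
    _ = _ := by ring

/-- Events depending on disjoint pairs of members of an independent family are independent. -/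
theorem measure_forall_pair_mem_le {I ι : Type*} {X : I → Ω → ℕ} (hX : ∀ i, Measurable (X i))
    (hind : iIndepFun X P) (J : Finset ι) {a b : ι → I} (ha : Set.InjOn a J)
    (hb : Set.InjOn b J) (hab : ∀ k ∈ J, ∀ l ∈ J, a k ≠ b l) (E : ι → Set (ℕ × ℕ))
    {c : ENNReal} (hE : ∀ k ∈ J, P {x | (X (a k) x, X (b k) x) ∈ E k} ≤ c) :
    P {x | ∀ k ∈ J, (X (a k) x, X (b k) x) ∈ E k} ≤ c ^ J.card := by
  classical
  have := hind.isProbabilityMeasure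
  induction J using Finset.induction_on with
  | empty => simp
  | insert k J hk ih =>
    set S : Finset I := J.image a ∪ J.image b with hS
    set T : Finset I := {a k, b k} with hT
    have hST : Disjoint S T := by
      rw [Finset.disjoint_left]
      intro i hi hiT
      simp only [hS, hT, Finset.mem_union, Finset.mem_image, Finset.mem_insert,
        Finset.mem_singleton] at hi hiT
      have hkk : k ∈ insert k J := Finset.mem_insert_self k J
      have hJ : ∀ j ∈ J, j ∈ insert k J := fun j hj => Finset.mem_insert_of_mem hj
      rcases hi with ⟨j, hj, rfl⟩ | ⟨j, hj, rfl⟩ <;> rcases hiT with h | h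
      · exact hk (ha (by exact_mod_cast hJ j hj) (by exact_mod_cast hkk) h ▸ hj)
      · exact hab j (hJ j hj) k hkk h
      · exact hab k hkk j (hJ j hj) h.symm
      · exact hk (hb (by exact_mod_cast hJ j hj) (by exact_mod_cast hkk) h ▸ hj)
    have hI := hind.indepFun_finset S T hST hX
    have haS : ∀ j ∈ J, a j ∈ S := fun j hj =>
      Finset.mem_union_left _ (Finset.mem_image_of_mem a hj)
    have hbS : ∀ j ∈ J, b j ∈ S := fun j hj =>
      Finset.mem_union_right _ (Finset.mem_image_of_mem b hj)
    have haT : a k ∈ T := by simp [hT]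
    have hbT : b k ∈ T := by simp [hT]
    have hset : {x | ∀ j ∈ insert k J, (X (a j) x, X (b j) x) ∈ E j} =
        (fun x (i : S) => X i x) ⁻¹'
            {z | ∀ j (hj : j ∈ J), (z ⟨a j, haS j hj⟩, z ⟨b j, hbS j hj⟩) ∈ E j} ∩
          (fun x (i : T) => X i x) ⁻¹' {z | (z ⟨a k, haT⟩, z ⟨b k, hbT⟩) ∈ E k} := by
      ext x
      simp only [Finset.forall_mem_insert, Set.mem_ofPred_eq, Set.mem_inter_iff, Set.mem_preimage]
      tauto
    rw [hset, hI.measure_inter_preimage_eq_mul _ _ (Set.to_countable _).measurableSet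
      (Set.to_countable _).measurableSet, Finset.card_insert_of_notMem hk, pow_succ]
    refine mul_le_mul' ?_ (hE k (Finset.mem_insert_self k J))
    refine ih (ha.mono (by simp)) (hb.mono (by simp)) (fun i hi j hj =>
      hab i (Finset.mem_insert_of_mem hi) j (Finset.mem_insert_of_mem hj))
      fun j hj => hE j (Finset.mem_insert_of_mem hj)

/-- Integrating out a bound that holds for each fixed value of an independent variable. -/
theorem measure_mem_le_of_indepFun [IsProbabilityMeasure P] {𝓨 𝓩 : Type*} [MeasurableSpace 𝓨]
    [MeasurableSpace 𝓩] [DiscreteMeasurableSpace 𝓨] [DiscreteMeasurableSpace 𝓩] [Countable 𝓨]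
    [Countable 𝓩] {Y : Ω → 𝓨} {Z : Ω → 𝓩} (hY : Measurable Y) (hZ : Measurable Z)
    (hYZ : IndepFun Y Z P) (E : 𝓨 → Set 𝓩) {δ : ENNReal}
    (hE : ∀ y, P {x | Z x ∈ E y} ≤ δ) : P {x | Z x ∈ E (Y x)} ≤ δ := by
  have hm : MeasurableSet {p : 𝓨 × 𝓩 | p.2 ∈ E p.1} := (Set.to_countable _).measurableSet
  have : {x | Z x ∈ E (Y x)} = (fun x => (Y x, Z x)) ⁻¹' {p : 𝓨 × 𝓩 | p.2 ∈ E p.1} := rfl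
  have hPY : IsProbabilityMeasure (P.map Y) := Measure.isProbabilityMeasure_map hY.aemeasurable
  rw [this, ← Measure.map_apply (hY.prodMk hZ) hm,
    (indepFun_iff_map_prod_eq_prod_map_map hY.aemeasurable hZ.aemeasurable).1 hYZ]
  rw [Measure.prod_apply hm]
  calc _ ≤ ∫⁻ _, δ ∂(P.map Y) := by
        refine lintegral_mono fun y => ?_
        rw [Measure.map_apply hZ (Set.to_countable _).measurableSet]
        exact hE y
    _ = δ := by simp

end Probability

namespace IcebergScheme

variable {A : Type*} (S : IcebergScheme A)

/-- Conditionally on the steps below `n`, the rotation parameters of step `n` are independent and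
uniform: a family of events, each depending on its own pair of parameters of step `n` and on the
lower steps, and each of conditional probability at most `c`. -/
theorem measure_forall_pair_mem_le {Ω : Type*} [MeasurableSpace Ω] {P : Measure Ω}
    [IsProbabilityMeasure P] {ω : ℕ → ℕ → Ω → ℕ}
    (hzero : ∀ n x, ω n 0 x = 0)
    (hmeas : ∀ n j, 1 ≤ j → j < S.q n → Measurable (ω n j))
    (hunif : ∀ n j, 1 ≤ j → j < S.q n → P.map (ω n j) = uniformOn (Set.Iio (S.height n)))
    (hindep : iIndepFun
      (fun (p : {p : ℕ × ℕ // 1 ≤ p.2 ∧ p.2 < S.q p.1}) => ω p.1.1 p.1.2) P)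
    (n : ℕ) {ι : Type*} (J : Finset ι) {a b : ι → ℕ}
    (ha : ∀ k ∈ J, 1 ≤ a k ∧ a k < S.q n) (hb : ∀ k ∈ J, 1 ≤ b k ∧ b k < S.q n)
    (hai : Set.InjOn a J) (hbi : Set.InjOn b J) (hab : ∀ k ∈ J, ∀ l ∈ J, a k ≠ b l)
    (E : (ℕ → ℕ → ℕ) → ι → Set (ℕ × ℕ))
    (hlow : ∀ α β, (∀ m < n, ∀ j < S.q m, α m j = β m j) → E α = E β) {c : ℝ} (hc : 0 ≤ c)
    (hE : open Classical in ∀ α, ∀ k ∈ J,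
      (((Finset.range (S.height n) ×ˢ Finset.range (S.height n)).filter (· ∈ E α k)).card : ℝ) ≤
        c * (S.height n : ℝ) ^ 2) :
    P {x | ∀ k ∈ J, (ω n (a k) x, ω n (b k) x) ∈ E (fun m j => ω m j x) k} ≤
      ENNReal.ofReal (c ^ J.card) := by
  classical
  let I := {p : ℕ × ℕ // 1 ≤ p.2 ∧ p.2 < S.q p.1}
  have hX : ∀ p : I, Measurable (ω p.1.1 p.1.2) := fun p => hmeas _ _ p.2.1 p.2.2
  have hfin : ({p : I | p.1.1 < n}).Finite := by
    refine Set.Finite.of_finite_image (f := Subtype.val) ?_ Subtype.val_injective.injOn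
    refine ((Finset.range n).biUnion
      fun m => (Finset.range (S.q m)).image fun j => (m, j)).finite_toSet.subset ?_
    rintro _ ⟨p, hp, rfl⟩
    simp only [Finset.coe_biUnion, Set.mem_iUnion]
    exact ⟨p.1.1, by simpa using hp, by simpa using ⟨p.1.2, p.2.2, rfl⟩⟩
  set S₀ : Finset I := hfin.toFinset with hS₀
  set a' : J → I := fun k => ⟨(n, a k), ha k k.2⟩ with ha'
  set b' : J → I := fun k => ⟨(n, b k), hb k k.2⟩ with hb'
  set T : Finset I := Finset.univ.image a' ∪ Finset.univ.image b' with hT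
  have haT : ∀ k, a' k ∈ T := fun k =>
    Finset.mem_union_left _ (Finset.mem_image_of_mem a' (Finset.mem_univ k))
  have hbT : ∀ k, b' k ∈ T := fun k =>
    Finset.mem_union_right _ (Finset.mem_image_of_mem b' (Finset.mem_univ k))
  have hST : Disjoint S₀ T := by
    rw [Finset.disjoint_left]
    intro p hp hpT
    simp only [hS₀, Set.Finite.mem_toFinset, Set.mem_ofPred_eq] at hp
    simp only [hT, Finset.mem_union, Finset.mem_image] at hpT
    rcases hpT with ⟨k, -, rfl⟩ | ⟨k, -, rfl⟩ <;> simp [ha', hb'] at hp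
  have hI := hindep.indepFun_finset S₀ T hST hX
  -- The finitely many lower parameters are completed to a full array. The default 0 is the true
  -- value at `j = 0`; the other default entries are irrelevant by `hlow`.
  let D : (S₀ → ℕ) → ℕ → ℕ → ℕ := fun y m j =>
    if h : ∃ hp : 1 ≤ j ∧ j < S.q m, (⟨(m, j), hp⟩ : I) ∈ S₀ then y ⟨⟨(m, j), h.1⟩, h.2⟩ else 0
  have hD : ∀ x, E (fun m j => ω m j x) = E (D fun i => ω i.1.1.1 i.1.1.2 x) := by
    intro x
    refine hlow _ _ fun m hm j hj => ?_
    rcases Nat.eq_zero_or_pos j with rfl | hj1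
    · rw [hzero]; simp [D]
    · have : ∃ hp : 1 ≤ j ∧ j < S.q m, (⟨(m, j), hp⟩ : I) ∈ S₀ :=
        ⟨⟨hj1, hj⟩, hfin.mem_toFinset.2 hm⟩
      simp only [D, dif_pos this]
  have hmain := measure_mem_le_of_indepFun (P := P)
    (Y := fun x (i : S₀) => ω i.1.1.1 i.1.1.2 x) (Z := fun x (i : T) => ω i.1.1.1 i.1.1.2 x)
    (measurable_pi_lambda _ fun i => hX i) (measurable_pi_lambda _ fun i => hX i) hI
    (fun y => {z | ∀ k : J, (z ⟨a' k, haT k⟩, z ⟨b' k, hbT k⟩) ∈ E (D y) k})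
    (δ := ENNReal.ofReal (c ^ J.card)) ?_
  · refine (measure_mono ?_).trans hmain
    intro x hx k
    have := hx k.1 k.2
    rw [hD] at this
    exact this
  · intro y
    have hinj : Function.Injective a' := fun k l h =>
      Subtype.ext (hai k.2 l.2 (congrArg (fun p : I => p.1.2) h))
    have hinj' : Function.Injective b' := fun k l h =>
      Subtype.ext (hbi k.2 l.2 (congrArg (fun p : I => p.1.2) h))
    have hne : ∀ k l, a' k ≠ b' l := fun k l h =>
      hab k k.2 l l.2 (congrArg (fun p : I => p.1.2) h)
    have hpair : ∀ k : J, P {x | (ω n (a k) x, ω n (b k) x) ∈ E (D y) k} ≤ ENNReal.ofReal c := by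
      intro k
      have hind : IndepFun (ω n (a k)) (ω n (b k)) P := hindep.indepFun (hne k k)
      obtain ⟨ha1, ha2⟩ := ha k k.2
      obtain ⟨hb1, hb2⟩ := hb k k.2
      exact measure_pair_mem_le_of_uniformOn (S.height_pos n) (hmeas _ _ ha1 ha2)
        (hmeas _ _ hb1 hb2) (hunif _ _ ha1 ha2) (hunif _ _ hb1 hb2) hind (E (D y) k)
        (hE (D y) k k.2)
    have := _root_.measure_forall_pair_mem_le (P := P) hX hindep (Finset.univ : Finset J)
      (a := a') (b := b') hinj.injOn hinj'.injOn (fun k _ l _ => hne k l)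
      (fun k => E (D y) k) (c := ENNReal.ofReal c) (fun k _ => hpair k)
    rw [Finset.card_univ, Fintype.card_coe] at this
    rw [ENNReal.ofReal_pow hc]
    refine (measure_mono ?_).trans this
    intro x hx k _
    exact hx k

end IcebergScheme

/-! ### Short segments determine their position -/

/-- Greedy choice: taking `x` excludes at most three elements, namely `x`, `f x` and the preimage of
`x`. The resulting pairs (k, f k) are disjoint, so events attached to them are independent. -/
theorem Finset.exists_subset_forall_ne_apply {α : Type*} (f : α → α) (s : Finset α)
    (hinj : Set.InjOn f s) (hne : ∀ x ∈ s, f x ≠ x) :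
    ∃ t ⊆ s, s.card ≤ 3 * t.card ∧ ∀ k ∈ t, ∀ l ∈ t, k ≠ f l := by
  classical
  induction s using Finset.strongInduction with
  | H s ih =>
    rcases s.eq_empty_or_nonempty with rfl | ⟨x, hx⟩
    · exact ⟨∅, by simp⟩
    set s' := s.filter (fun z => z ≠ x ∧ z ≠ f x ∧ f z ≠ x) with hs'
    have hsub : s' ⊆ s := Finset.filter_subset _ _
    have hx' : x ∉ s' := by simp [hs']
    obtain ⟨t, hts, hcard, ht⟩ := ih s' (Finset.ssubset_iff_subset_ne.2
      ⟨hsub, fun h => hx' (h ▸ hx)⟩) (hinj.mono (by exact_mod_cast hsub))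
      fun z hz => hne z (hsub hz)
    have hxt : x ∉ t := fun h => hx' (hts h)
    refine ⟨insert x t, Finset.insert_subset hx (hts.trans hsub), ?_, ?_⟩
    · have hpre : (s.filter fun z => f z = x).card ≤ 1 := by
        rw [Finset.card_le_one]
        intro a ha b hb
        simp only [Finset.mem_filter] at ha hb
        exact hinj ha.1 hb.1 (ha.2.trans hb.2.symm)
      have hcover : s ⊆ s' ∪ ({x, f x} ∪ s.filter fun z => f z = x) := by
        intro z hz
        simp only [hs', Finset.mem_union, Finset.mem_filter, Finset.mem_insert,
          Finset.mem_singleton]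
        tauto
      have h1 := Finset.card_le_card hcover
      have h2 := Finset.card_union_le s' ({x, f x} ∪ s.filter fun z => f z = x)
      have h3 := Finset.card_union_le {x, f x} (s.filter fun z => f z = x)
      have h4 := Finset.card_le_two (a := x) (b := f x)
      rw [Finset.card_insert_of_notMem hxt]
      omega
    · intro k hk l hl
      rcases Finset.mem_insert.1 hk with rfl | hk' <;> rcases Finset.mem_insert.1 hl with rfl | hl'
      · exact (hne _ hx).symm
      · have := hts hl'
        simp only [hs', Finset.mem_filter] at this
        exact this.2.2.2.symm
      · have := hts hk'
        simp only [hs', Finset.mem_filter] at this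
        exact this.2.2.1
      · exact ht k hk' l hl'

namespace IcebergScheme

variable {A : Type*} (S : IcebergScheme A)

/-- A segment of the periodic word of step `n` whose length is a third of the period determines its
position modulo the period. -/
def SegmentsDeterminePosition (α : ℕ → ℕ → ℕ) (n : ℕ) : Prop :=
  ∀ i j, (∀ k < S.height n / 3, S.cyclicWord α n (i + k) = S.cyclicWord α n (j + k)) →
    i ≡ j [MOD S.height n]

variable {S}

theorem exists_shift_of_not_segmentsDeterminePosition {α : ℕ → ℕ → ℕ} {n : ℕ}
    (h : ¬ S.SegmentsDeterminePosition α n) :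
    ∃ i < S.height n, ∃ d < S.height n, 0 < d ∧ ∀ k < S.height n / 3,
      S.cyclicWord α n (i + k) = S.cyclicWord α n (i + d + k) := by
  simp only [SegmentsDeterminePosition, not_forall] at h
  obtain ⟨i, j, hij, hne⟩ := h
  set H := S.height n with hH
  have hi : i % H < H := Nat.mod_lt i (S.height_pos n)
  have hj : j % H < H := Nat.mod_lt j (S.height_pos n)
  have hne' : i % H ≠ j % H := hne
  have hmod : ∀ k < H / 3,
      S.cyclicWord α n (i % H + k) = S.cyclicWord α n (j % H + k) := fun k hk => by
    rw [cyclicWord_congr ((Nat.mod_modEq i H).add_right k),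
      cyclicWord_congr ((Nat.mod_modEq j H).add_right k)]
    exact hij k hk
  rcases lt_or_gt_of_ne hne' with hlt | hlt
  · refine ⟨i % H, hi, j % H - i % H, by omega, by omega, fun k hk => ?_⟩
    rw [Nat.add_sub_cancel' hlt.le]
    exact hmod k hk
  · refine ⟨j % H, hj, i % H - j % H, by omega, by omega, fun k hk => ?_⟩
    rw [Nat.add_sub_cancel' hlt.le]
    exact (hmod k hk).symm

theorem cyclicWord_succ_block (α : ℕ → ℕ → ℕ) (n B r : ℕ) (hr : r < S.height n) :
    S.cyclicWord α (n + 1) (B * S.height n + r) = S.cyclicWord α n (r + α n (B % S.q n)) := by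
  have hd : (B * S.height n + r) / S.height n = B := by
    rw [mul_comm, Nat.mul_add_div (S.height_pos n), Nat.div_eq_of_lt hr, add_zero]
  rw [cyclicWord_succ, hd]
  refine cyclicWord_congr ?_
  simp [Nat.ModEq, add_assoc]

open Classical in
/-- Two independent uniform letters agree with probability at most `1 - 1 / h 0`. -/
theorem card_cyclicWord_eq_le (α : ℕ → ℕ → ℕ) (n r r' : ℕ) :
    (((Finset.range (S.height n) ×ˢ Finset.range (S.height n)).filter
      fun p => S.cyclicWord α n (r + p.1) = S.cyclicWord α n (r' + p.2)).card : ℝ) ≤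
      (1 - 1 / (S.height 0 : ℝ)) * (S.height n : ℝ) ^ 2 := by
  set h := S.height n with hh
  have h0 : (0 : ℝ) < S.height 0 := by exact_mod_cast S.height_pos 0
  have hrow : ∀ s ∈ Finset.range h,
      (((Finset.range h).filter
        fun s' => S.cyclicWord α n (r + s) = S.cyclicWord α n (r' + s')).card : ℝ) ≤
        (1 - 1 / (S.height 0 : ℝ)) * h := by
    intro s _
    have h1 := Finset.card_filter_add_card_filter_not (s := Finset.range h)
      (fun s' => S.cyclicWord α n (r' + s') ≠ S.cyclicWord α n (r + s))
    have h2 := count_cyclicWord_add (S := S) α n r' (S.cyclicWord α n (r + s))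
    rw [Nat.count_eq_card_filter_range, ← hh] at h2
    rw [h2, Finset.card_range] at h1
    have h3 : ((Finset.range h).filter
        fun s' => S.cyclicWord α n (r + s) = S.cyclicWord α n (r' + s')).card =
        ((Finset.range h).filter
        fun s' => ¬ S.cyclicWord α n (r' + s') ≠ S.cyclicWord α n (r + s)).card := by
      congr 1
      refine Finset.filter_congr fun s' _ => ?_
      rw [not_not, eq_comm]
    rw [h3]
    have h4 : (h : ℝ) ≤ S.height 0 * S.neCount α n (S.cyclicWord α n (r + s)) := by
      exact_mod_cast height_le_neCount (S := S) α n _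
    have h5 : (S.neCount α n (S.cyclicWord α n (r + s)) : ℝ) +
      (((Finset.range h).filter
        fun s' => ¬ S.cyclicWord α n (r' + s') ≠ S.cyclicWord α n (r + s)).card : ℝ) = h := by
      exact_mod_cast h1
    have h6 : (h : ℝ) / S.height 0 ≤ S.neCount α n (S.cyclicWord α n (r + s)) := by
      rw [div_le_iff₀ h0]; linarith
    have h7 : (1 - 1 / (S.height 0 : ℝ)) * h = h - h / S.height 0 := by ring
    linarith
  have hcard : ((Finset.range h ×ˢ Finset.range h).filter
      fun p : ℕ × ℕ => S.cyclicWord α n (r + p.1) = S.cyclicWord α n (r' + p.2)).card =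
      ∑ s ∈ Finset.range h, ((Finset.range h).filter
        fun s' => S.cyclicWord α n (r + s) = S.cyclicWord α n (r' + s')).card := by
    simp only [Finset.card_filter, Finset.sum_product]
  rw [hcard]
  push_cast
  calc _ ≤ ∑ s ∈ Finset.range h, (1 - 1 / (S.height 0 : ℝ)) * (h : ℝ) := Finset.sum_le_sum hrow
    _ = _ := by rw [Finset.sum_const, Finset.card_range, nsmul_eq_mul]; ring

theorem one_sub_inv_height_nonneg : (0 : ℝ) ≤ 1 - 1 / (S.height 0 : ℝ) := by
  have : (1 : ℝ) ≤ S.height 0 := by exact_mod_cast S.height_pos 0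
  rw [sub_nonneg, div_le_one (by linarith)]
  exact this

theorem one_sub_inv_height_lt_one : 1 - 1 / (S.height 0 : ℝ) < 1 := by
  have : (0 : ℝ) < S.height 0 := by exact_mod_cast S.height_pos 0
  have : 0 < 1 / (S.height 0 : ℝ) := by positivity
  linarith

variable {Ω : Type*} [MeasurableSpace Ω] {P : Measure Ω} [IsProbabilityMeasure P]
  {ω : ℕ → ℕ → Ω → ℕ}

/-- One letter is compared in each block of the segment: offset `r` in block B must match offset
`r'` in block B + D. The two blocks are rotated independently, so a match has conditional
probability at most 1 - 1 / `S.height 0`. The exponent counts disjoint pairs of blocks among the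
roughly q / 3 blocks of the segment. -/
theorem measure_shift_le
    (hzero : ∀ n x, ω n 0 x = 0)
    (hmeas : ∀ n j, 1 ≤ j → j < S.q n → Measurable (ω n j))
    (hunif : ∀ n j, 1 ≤ j → j < S.q n → P.map (ω n j) = uniformOn (Set.Iio (S.height n)))
    (hindep : iIndepFun
      (fun (p : {p : ℕ × ℕ // 1 ≤ p.2 ∧ p.2 < S.q p.1}) => ω p.1.1 p.1.2) P)
    (n i d : ℕ) (hd : 0 < d) (hdH : d < S.height (n + 1)) :
    P {x | ∀ k < S.height (n + 1) / 3, S.cyclicWord (fun m j => ω m j x) (n + 1) (i + k) =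
      S.cyclicWord (fun m j => ω m j x) (n + 1) (i + d + k)} ≤
      ENNReal.ofReal ((1 - 1 / (S.height 0 : ℝ)) ^ (S.q n / 9 - 1)) := by
  classical
  set h := S.height n with hh
  set q := S.q n with hq
  have hpos : 0 < h := S.height_pos n
  have hqpos : 2 ≤ q := S.two_le_q n
  -- The compared letters must lie in different blocks. If the shift is shorter than a block, the
  -- last letter of a block is used, since it is moved into the next one.
  obtain ⟨r, r', D, hr, hr', hD1, hDq, hrd⟩ : ∃ r r' D, r < h ∧ r' < h ∧ 1 ≤ D ∧ D < q ∧
      r + d = D * h + r' := by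
    rcases lt_or_ge d h with hdh | hdh
    · exact ⟨h - 1, d - 1, 1, by omega, by omega, le_rfl, by omega, by omega⟩
    · refine ⟨0, d % h, d / h, hpos, Nat.mod_lt _ hpos, ?_, ?_, ?_⟩
      · exact (Nat.one_le_div_iff hpos).2 hdh
      · exact Nat.div_lt_of_lt_mul (by rw [mul_comm]; exact hdH)
      · rw [mul_comm, zero_add, Nat.div_add_mod]
  set f : ℕ → ℕ := fun x => (x + D) % q with hf
  set B₀ := i / h + 1 with hB₀
  -- One block is given up because the segment need not start at a block boundary.
  set m := q / 3 - 1 with hm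
  set s : Finset ℕ := (Finset.range m).image fun k => (B₀ + k) % q with hs
  have hsq : ∀ x ∈ s, x < q := by
    intro x hx
    obtain ⟨k, -, rfl⟩ := Finset.mem_image.1 hx
    exact Nat.mod_lt _ (by omega)
  have hmodinj : ∀ c, Set.InjOn (fun x => (c + x) % q) {x | x < q} := by
    intro c x hx y hy hxy
    have : x ≡ y [MOD q] := Nat.ModEq.add_left_cancel' c hxy
    exact Nat.ModEq.eq_of_lt_of_lt this hx hy
  have hscard : s.card = m := by
    rw [hs, Finset.card_image_of_injOn, Finset.card_range]
    exact (hmodinj B₀).mono fun k hk => by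
      have : k < m := by simpa using hk
      show k < q
      omega
  have hfinj : Set.InjOn f {x | x < q} := by
    intro x hx y hy hxy
    refine hmodinj D hx hy ?_
    simpa [hf, add_comm] using hxy
  -- Block 0 is not rotated at random; at most two pairs involve it.
  set s' := s.filter fun x => x ≠ 0 ∧ f x ≠ 0 with hs'
  have hs's : s' ⊆ s := Finset.filter_subset _ _
  have hs'card : m ≤ s'.card + 2 := by
    have h1 : (s.filter fun x => f x = 0).card ≤ 1 := by
      rw [Finset.card_le_one]
      intro a ha b hb
      simp only [Finset.mem_filter] at ha hb
      exact hfinj (hsq a ha.1) (hsq b hb.1) (ha.2.trans hb.2.symm)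
    have hcover : s ⊆ s' ∪ ({0} ∪ s.filter fun x => f x = 0) := by
      intro z hz
      simp only [hs', Finset.mem_union, Finset.mem_filter, Finset.mem_singleton]
      tauto
    have h2 := Finset.card_le_card hcover
    have h3 := Finset.card_union_le s' ({0} ∪ s.filter fun x => f x = 0)
    have h4 := Finset.card_union_le {0} (s.filter fun x => f x = 0)
    rw [Finset.card_singleton] at h4
    omega
  obtain ⟨J, hJs, hJcard, hJ⟩ := Finset.exists_subset_forall_ne_apply f s'
    (hfinj.mono fun x hx => hsq x (hs's hx)) (fun x hx => by
      have hxq := hsq x (hs's hx)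
      intro hfx
      have h1 : x + D ≡ x + 0 [MOD q] := by
        show (x + D) % q = (x + 0) % q
        rw [add_zero, Nat.mod_eq_of_lt hxq]; exact hfx
      have h2 : D ≡ 0 [MOD q] := Nat.ModEq.add_left_cancel' x h1
      have := Nat.ModEq.eq_of_lt_of_lt h2 hDq (by omega)
      omega)
  have hJq : ∀ k ∈ J, (1 ≤ k ∧ k < q) ∧ (1 ≤ f k ∧ f k < q) := by
    intro k hk
    have h1 := hsq k (hs's (hJs hk))
    have h2 := hJs hk
    simp only [hs', Finset.mem_filter] at h2
    have h3 : f k < q := Nat.mod_lt _ (by omega)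
    omega
  have hmain := S.measure_forall_pair_mem_le hzero hmeas hunif hindep n J (a := id) (b := f)
    (fun k hk => (hJq k hk).1) (fun k hk => (hJq k hk).2) Function.injective_id.injOn
    (hfinj.mono fun x hx => (hJq x hx).1.2) hJ
    (fun α _ => {p | S.cyclicWord α n (r + p.1) = S.cyclicWord α n (r' + p.2)})
    (fun α β hαβ => by rw [cyclicWord_eq_of_forall hαβ])
    one_sub_inv_height_nonneg (fun α k _ => card_cyclicWord_eq_le α n r r')
  refine (measure_mono ?_).trans (hmain.trans (ENNReal.ofReal_le_ofReal ?_))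
  · intro x hx k hk
    obtain ⟨l, hl, rfl⟩ := Finset.mem_image.1 (hs's (hJs hk))
    rw [Finset.mem_range] at hl
    have h1 : (B₀ + l) * h = (i / h) * h + h + l * h := by rw [hB₀]; ring
    have h2 := Nat.div_add_mod i h
    rw [mul_comm] at h2
    have h3 := Nat.mod_lt i hpos
    have hlm : (l + 1) * h ≤ m * h := Nat.mul_le_mul_right _ hl
    have hmL : (m + 1) * h ≤ S.height (n + 1) / 3 := by
      rw [Nat.le_div_iff_mul_le (by norm_num), height_succ, ← hh, ← hq]
      have : (m + 1) * 3 ≤ q := by omega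
      calc (m + 1) * h * 3 = ((m + 1) * 3) * h := by ring
        _ ≤ q * h := Nat.mul_le_mul_right _ this
    rw [add_mul, one_mul] at hlm hmL
    have hk := hx ((B₀ + l) * h + r - i) (by omega)
    rw [show i + ((B₀ + l) * h + r - i) = (B₀ + l) * h + r by omega,
      show i + d + ((B₀ + l) * h + r - i) = (B₀ + l + D) * h + r' by
        rw [add_mul (B₀ + l)]; omega,
      cyclicWord_succ_block _ _ _ _ hr, cyclicWord_succ_block _ _ _ _ hr'] at hk
    simpa [hf, hq] using hk
  -- At least (m - 2) / 3 pairs survive, with m = q / 3 - 1, which gives q / 9 - 1.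
  · exact pow_le_pow_of_le_one one_sub_inv_height_nonneg one_sub_inv_height_lt_one.le (by omega)

theorem measure_not_segmentsDeterminePosition_le
    (hzero : ∀ n x, ω n 0 x = 0)
    (hmeas : ∀ n j, 1 ≤ j → j < S.q n → Measurable (ω n j))
    (hunif : ∀ n j, 1 ≤ j → j < S.q n → P.map (ω n j) = uniformOn (Set.Iio (S.height n)))
    (hindep : iIndepFun
      (fun (p : {p : ℕ × ℕ // 1 ≤ p.2 ∧ p.2 < S.q p.1}) => ω p.1.1 p.1.2) P) (n : ℕ) :
    P {x | ¬ S.SegmentsDeterminePosition (fun m j => ω m j x) (n + 1)} ≤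
      ENNReal.ofReal ((S.height (n + 1) : ℝ) ^ 2 *
        (1 - 1 / (S.height 0 : ℝ)) ^ (S.q n / 9 - 1)) := by
  set H := S.height (n + 1) with hH
  let bad : ℕ × ℕ → Set Ω := fun p =>
    {x | 0 < p.2 ∧ ∀ k < H / 3, S.cyclicWord (fun m j => ω m j x) (n + 1) (p.1 + k) =
      S.cyclicWord (fun m j => ω m j x) (n + 1) (p.1 + p.2 + k)}
  have hsub : {x | ¬ S.SegmentsDeterminePosition (fun m j => ω m j x) (n + 1)} ⊆
      ⋃ p ∈ Finset.range H ×ˢ Finset.range H, bad p := by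
    intro x hx
    obtain ⟨i, hi, d, hd, hd0, hk⟩ := exists_shift_of_not_segmentsDeterminePosition hx
    simp only [Set.mem_iUnion]
    exact ⟨(i, d), by simp [hH, hi, hd], hd0, hk⟩
  refine (measure_mono hsub).trans ((measure_biUnion_finset_le _ _).trans ?_)
  have hbad : ∀ p ∈ Finset.range H ×ˢ Finset.range H, P (bad p) ≤
      ENNReal.ofReal ((1 - 1 / (S.height 0 : ℝ)) ^ (S.q n / 9 - 1)) := by
    intro p hp
    rcases Nat.eq_zero_or_pos p.2 with h0 | h0
    · simp [bad, h0]
    · refine (measure_mono fun x hx => hx.2).trans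
        (measure_shift_le hzero hmeas hunif hindep n p.1 p.2 h0 ?_)
      exact Finset.mem_range.1 (Finset.mem_product.1 hp).2
  refine (Finset.sum_le_sum hbad).trans (le_of_eq ?_)
  rw [Finset.sum_const, Finset.card_product, Finset.card_range, nsmul_eq_mul,
    ENNReal.ofReal_mul (by positivity), sq, ← Nat.cast_mul, ENNReal.ofReal_natCast]

end IcebergScheme

/-! ### Visible seams and the number of their phases -/

theorem Finset.card_filter_range_mul (p : ℕ → Prop) [DecidablePred p] (q h : ℕ) :
    ((Finset.range (q * h)).filter p).card =
      ∑ B ∈ Finset.range q, ((Finset.range h).filter fun s => p (B * h + s)).card := by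
  induction q with
  | zero => simp
  | succ q ih =>
    rw [Finset.sum_range_succ, ← ih, add_mul, one_mul]
    simp only [← Nat.count_eq_card_filter_range]
    rw [Nat.count_add]

namespace IcebergScheme

variable {A : Type*} (S : IcebergScheme A)

/-- The position in the word of step `n` of the letter number `X` of the word of step `n + 1`. -/
def phase (α : ℕ → ℕ → ℕ) (n X : ℕ) : ℕ :=
  (X + α n (X / S.height n % S.q n)) % S.height n

/-- The junction of two copies of the word of step `n + 1`, the first one rotated by `p.1` and the
second one by `p.2`, is a visible seam if the two pieces of copies of the word of step `n` that meet
there have lengths at least two thirds of `S.height n`, and the letters that follow the junction in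
the two copies are different. -/
def IsSeam (α : ℕ → ℕ → ℕ) (n : ℕ) (p : ℕ × ℕ) : Prop :=
  S.height n - S.height n / 3 ≤ p.1 % S.height n ∧ p.2 % S.height n < S.height n / 3 ∧
    S.cyclicWord α n (S.phase α n p.1) ≠ S.cyclicWord α n (S.phase α n p.2)

variable {S}

theorem phase_lt (α : ℕ → ℕ → ℕ) (n X : ℕ) : S.phase α n X < S.height n :=
  Nat.mod_lt _ (S.height_pos n)

theorem phase_block (α : ℕ → ℕ → ℕ) (n : ℕ) {B s : ℕ} (hs : s < S.height n) (hB : B < S.q n) :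
    S.phase α n (B * S.height n + s) = (α n B + s) % S.height n := by
  have hd : (B * S.height n + s) / S.height n = B := by
    rw [mul_comm, Nat.mul_add_div (S.height_pos n), Nat.div_eq_of_lt hs, add_zero]
  rw [phase, hd, Nat.mod_eq_of_lt hB, add_assoc, Nat.mul_add_mod_self_right, add_comm]

/-- On each block the phase is a rotation, so each value is taken at most once per block. A small
set of phases thus has a proportionally small preimage. -/
theorem card_phase_eq_le (α : ℕ → ℕ → ℕ) (n x : ℕ) :
    ((Finset.range (S.height (n + 1))).filter fun X => S.phase α n X = x).card ≤ S.q n := by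
  rw [height_succ, Finset.card_filter_range_mul]
  refine (Finset.sum_le_card_nsmul _ _ 1 ?_).trans (by simp)
  intro B hB
  rw [Finset.card_le_one]
  intro s hs s' hs'
  simp only [Finset.mem_filter, Finset.mem_range] at hs hs' hB
  rw [phase_block α n hs.1 hB] at hs
  rw [phase_block α n hs'.1 hB] at hs'
  exact Nat.ModEq.eq_of_lt_of_lt (Nat.ModEq.add_left_cancel' (α n B) (hs.2.trans hs'.2.symm))
    hs.1 hs'.1

theorem card_left_ge (n : ℕ) : S.q n * (S.height n / 3) ≤
    ((Finset.range (S.height (n + 1))).filter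
      fun X => S.height n - S.height n / 3 ≤ X % S.height n).card := by
  rw [height_succ, Finset.card_filter_range_mul]
  refine le_trans (by simp) (Finset.card_nsmul_le_sum (Finset.range (S.q n)) _
    (S.height n / 3) ?_)
  intro B _
  have hsub : Finset.Ico (S.height n - S.height n / 3) (S.height n) ⊆
      (Finset.range (S.height n)).filter
        fun s => S.height n - S.height n / 3 ≤ (B * S.height n + s) % S.height n := by
    intro s hs
    simp only [Finset.mem_Ico, Finset.mem_filter, Finset.mem_range] at hs ⊢
    rw [Nat.mul_add_mod_self_right, Nat.mod_eq_of_lt hs.2]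
    exact ⟨hs.2, hs.1⟩
  have := Finset.card_le_card hsub
  rw [Nat.card_Ico] at this
  omega

open Classical in
-- In each block of step `n + 1` the phases of the first third form a segment of the periodic word.
-- It contains `S.q n / 3 - 1` whole blocks of step `n`, whose letter counts are known whatever the
-- rotation.
theorem card_right_ge (α : ℕ → ℕ → ℕ) (n : ℕ) (z : A) :
    S.q (n + 1) * ((S.q n / 3 - 1) * S.neCount α n z) ≤
      ((Finset.range (S.height (n + 2))).filter fun X =>
        X % S.height (n + 1) < S.height (n + 1) / 3 ∧
          z ≠ S.cyclicWord α (n + 1) (S.phase α (n + 1) X)).card := by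
  rw [height_succ S (n + 1), Finset.card_filter_range_mul]
  refine le_trans (by simp) (Finset.card_nsmul_le_sum (Finset.range (S.q (n + 1))) _
    ((S.q n / 3 - 1) * S.neCount α n z) ?_)
  intro B hB
  rw [Finset.mem_range] at hB
  rcases Nat.eq_zero_or_pos (S.q n / 3) with h0 | h0
  · simp [h0]
  have hl : (S.q n / 3 - 1 + 1) * S.height n ≤ S.height (n + 1) / 3 := by
    rw [Nat.le_div_iff_mul_le (by norm_num), height_succ, Nat.sub_add_cancel h0]
    calc S.q n / 3 * S.height n * 3 = (S.q n / 3 * 3) * S.height n := by ring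
      _ ≤ _ := Nat.mul_le_mul_right _ (Nat.div_mul_le_self _ _)
  refine (mul_neCount_le_count (S := S) α n (α (n + 1) B) _ _ hl z).trans ?_
  rw [Nat.count_eq_card_filter_range]
  refine Finset.card_le_card ?_
  intro s hs
  simp only [Finset.mem_filter, Finset.mem_range] at hs ⊢
  have hs1 : s < S.height (n + 1) := by omega
  refine ⟨hs1, ?_, ?_⟩
  · rw [Nat.mul_add_mod_self_right, Nat.mod_eq_of_lt hs1]; exact hs.1
  · rw [phase_block α _ hs1 hB, cyclicWord_congr (Nat.mod_modEq _ _)]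
    exact hs.2.symm

open Classical in
-- At least 1/4 of the left rotations are admissible. For each of them, at least 1 / (6 `S.height
-- 0`) of the right rotations satisfy both the length and the letter condition, whence 24 = 4 · 6.
-- The bound on `S.q n` absorbs the roundings.
theorem card_seam_ge (α : ℕ → ℕ → ℕ) (n : ℕ) (hq : 12 ≤ S.q n) :
    (S.height (n + 2)) ^ 2 ≤ 24 * S.height 0 *
      ((Finset.range (S.height (n + 2)) ×ˢ Finset.range (S.height (n + 2))).filter
        fun p => S.IsSeam α (n + 1) p).card := by
  set h := S.height (n + 1) with hh
  set H := S.height (n + 2) with hH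
  set N₁ := ((Finset.range H).filter fun X => h - h / 3 ≤ X % h).card with hN₁
  have hhq : S.q n ≤ h := Nat.le_mul_of_pos_right _ (S.height_pos n)
  have h1 : S.q (n + 1) * (h / 3) ≤ N₁ := card_left_ge (n + 1)
  have hrow : ∀ z : A, H ≤ 6 * S.height 0 * ((Finset.range H).filter fun X =>
        X % h < h / 3 ∧ z ≠ S.cyclicWord α (n + 1) (S.phase α (n + 1) X)).card := by
    intro z
    calc H = S.q (n + 1) * (S.q n * S.height n) := rfl
      _ ≤ S.q (n + 1) * ((6 * (S.q n / 3 - 1)) * (S.height 0 * S.neCount α n z)) := by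
          gcongr
          · omega
          · exact height_le_neCount α n z
      _ = 6 * S.height 0 * (S.q (n + 1) * ((S.q n / 3 - 1) * S.neCount α n z)) := by ring
      _ ≤ _ := Nat.mul_le_mul_left _ (card_right_ge α n z)
  have hprod : H * N₁ ≤ 6 * S.height 0 * ((Finset.range H ×ˢ Finset.range H).filter
      fun p => S.IsSeam α (n + 1) p).card := by
    have hcard : ((Finset.range H ×ˢ Finset.range H).filter
        fun p => S.IsSeam α (n + 1) p).card =
        ∑ X ∈ Finset.range H, if h - h / 3 ≤ X % h then ((Finset.range H).filter fun X' =>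
          X' % h < h / 3 ∧ S.cyclicWord α (n + 1) (S.phase α (n + 1) X) ≠
            S.cyclicWord α (n + 1) (S.phase α (n + 1) X')).card else 0 := by
      rw [Finset.card_filter, Finset.sum_product]
      refine Finset.sum_congr rfl fun X _ => ?_
      split_ifs with hX
      · rw [Finset.card_filter]
        refine Finset.sum_congr rfl fun X' _ => ?_
        simp only [IsSeam, ← hh, hX, true_and]
      · refine Finset.sum_eq_zero fun X' _ => ?_
        simp only [IsSeam, ← hh, hX, false_and, if_false]
    rw [hcard, Finset.mul_sum, hN₁, Finset.card_filter, Finset.mul_sum]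
    refine Finset.sum_le_sum fun X _ => ?_
    split_ifs with hX
    · rw [mul_one]; exact hrow _
    · simp
  calc H ^ 2 = H * (S.q (n + 1) * h) := by rw [sq]; rfl
    _ ≤ H * (S.q (n + 1) * (4 * (h / 3))) := by gcongr; omega
    _ = 4 * (H * (S.q (n + 1) * (h / 3))) := by ring
    _ ≤ 4 * (H * N₁) := by gcongr
    _ ≤ 4 * _ := Nat.mul_le_mul_left _ hprod
    _ = _ := by ring

open Classical in
theorem card_phase_mem_le (α : ℕ → ℕ → ℕ) (n : ℕ) (F : Finset (ℕ × ℕ)) :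
    ((Finset.range (S.height (n + 1)) ×ˢ Finset.range (S.height (n + 1))).filter
      fun p => (S.phase α n p.1, S.phase α n p.2) ∈ F).card ≤ F.card * S.q n ^ 2 := by
  refine (Finset.card_le_mul_card_image_of_maps_to
    (f := fun p : ℕ × ℕ => (S.phase α n p.1, S.phase α n p.2)) (t := F)
    (fun p hp => (Finset.mem_filter.1 hp).2) (S.q n ^ 2) ?_).trans (by rw [mul_comm])
  intro xy _
  have hsub : (((Finset.range (S.height (n + 1)) ×ˢ Finset.range (S.height (n + 1))).filter
      fun p => (S.phase α n p.1, S.phase α n p.2) ∈ F).filter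
      fun p => (S.phase α n p.1, S.phase α n p.2) = xy) ⊆
      ((Finset.range (S.height (n + 1))).filter fun X => S.phase α n X = xy.1) ×ˢ
      ((Finset.range (S.height (n + 1))).filter fun X => S.phase α n X = xy.2) := by
    rintro p hp
    simp only [Finset.mem_filter, Finset.mem_product] at hp ⊢
    obtain ⟨⟨⟨h1, h2⟩, -⟩, rfl⟩ := hp
    exact ⟨⟨h1, rfl⟩, h2, rfl⟩
  refine (Finset.card_le_card hsub).trans ?_
  rw [Finset.card_product, sq]
  exact Nat.mul_le_mul (card_phase_eq_le α n _) (card_phase_eq_le α n _)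

open Classical in
/-- A random junction is a seam with phases outside a given small set with positive probability. -/
theorem card_not_new_seam_le (α : ℕ → ℕ → ℕ) (n : ℕ) (hq : 12 ≤ S.q n) (F : Finset (ℕ × ℕ))
    (hF : 48 * S.height 0 * F.card ≤ S.height (n + 1) ^ 2) :
    (((Finset.range (S.height (n + 2)) ×ˢ Finset.range (S.height (n + 2))).filter
      fun p => S.IsSeam α (n + 1) p →
        (S.phase α (n + 1) p.1, S.phase α (n + 1) p.2) ∈ F).card : ℝ) ≤
      (1 - 1 / (48 * S.height 0 : ℝ)) * (S.height (n + 2) : ℝ) ^ 2 := by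
  set T := Finset.range (S.height (n + 2)) ×ˢ Finset.range (S.height (n + 2)) with hT
  have h1 := card_seam_ge (S := S) α n hq
  have h2 := card_phase_mem_le (S := S) α (n + 1) F
  rw [← hT] at h1 h2
  have h3 := Finset.card_filter_add_card_filter_not (s := T) (fun p => S.IsSeam α (n + 1) p)
  have h4 : (T.filter fun p => S.IsSeam α (n + 1) p →
        (S.phase α (n + 1) p.1, S.phase α (n + 1) p.2) ∈ F).card ≤
      (T.filter fun p => ¬ S.IsSeam α (n + 1) p).card +
      (T.filter fun p => (S.phase α (n + 1) p.1, S.phase α (n + 1) p.2) ∈ F).card := by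
    refine (Finset.card_le_card ?_).trans (Finset.card_union_le _ _)
    intro p hp
    simp only [Finset.mem_union, Finset.mem_filter] at hp ⊢
    tauto
  have hTc : T.card = S.height (n + 2) ^ 2 := by
    rw [hT, Finset.card_product, Finset.card_range, sq]
  rw [hTc] at h3
  have h5 : 48 * S.height 0 * (F.card * S.q (n + 1) ^ 2) ≤ S.height (n + 2) ^ 2 := by
    calc _ = (48 * S.height 0 * F.card) * S.q (n + 1) ^ 2 := by ring
      _ ≤ S.height (n + 1) ^ 2 * S.q (n + 1) ^ 2 := Nat.mul_le_mul_right _ hF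
      _ = _ := by rw [height_succ S (n + 1)]; ring
  have h0 : (0 : ℝ) < S.height 0 := by exact_mod_cast S.height_pos 0
  set a := (T.filter fun p => S.IsSeam α (n + 1) p).card
  set b := (T.filter fun p => ¬ S.IsSeam α (n + 1) p).card
  set c := (T.filter fun p => (S.phase α (n + 1) p.1, S.phase α (n + 1) p.2) ∈ F).card
  set d := (T.filter fun p => S.IsSeam α (n + 1) p →
        (S.phase α (n + 1) p.1, S.phase α (n + 1) p.2) ∈ F).card
  have h6 : 48 * S.height 0 * c ≤ S.height (n + 2) ^ 2 := (Nat.mul_le_mul_left _ h2).trans h5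
  rify at h1 h3 h4 h6
  set H : ℝ := (S.height (n + 2) : ℝ) with hH
  -- Seams fill at least 1 / (24 `S.height 0`) of the square and pairs with phases in `F` at most
  -- half of that, so the other half consists of new seams.
  have e1 : H ^ 2 / (24 * S.height 0) ≤ a := by
    rw [div_le_iff₀ (by positivity)]; linarith
  have e2 : (c : ℝ) ≤ H ^ 2 / (48 * S.height 0) := by
    rw [le_div_iff₀ (by positivity)]; linarith
  have e3 : H ^ 2 / (24 * S.height 0 : ℝ) = 2 * (H ^ 2 / (48 * S.height 0)) := by
    field_simp; ring
  have e4 : (1 - 1 / (48 * S.height 0 : ℝ)) * H ^ 2 = H ^ 2 - H ^ 2 / (48 * S.height 0) := by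
    ring
  rw [e4]
  linarith

open Classical in
/-- The pairs of phases of the visible seams at the first `N` even junctions of the word of
step `n + 2`. -/
noncomputable def seamPhases (S : IcebergScheme A) (α : ℕ → ℕ → ℕ) (n N : ℕ) : Finset (ℕ × ℕ) :=
  ((Finset.range N).filter fun k =>
    S.IsSeam α n (α (n + 1) (2 * k + 1), α (n + 1) (2 * k + 2))).image fun k =>
      (S.phase α n (α (n + 1) (2 * k + 1)), S.phase α n (α (n + 1) (2 * k + 2)))

theorem phase_eq_of_forall {α β : ℕ → ℕ → ℕ} {n : ℕ}
    (h : ∀ m < n + 1, ∀ j < S.q m, α m j = β m j) : S.phase α n = S.phase β n := by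
  funext X
  rw [phase, phase, h n n.lt_succ_self _ (Nat.mod_lt _ (S.q_pos n))]

theorem isSeam_eq_of_forall {α β : ℕ → ℕ → ℕ} {n : ℕ}
    (h : ∀ m < n + 1, ∀ j < S.q m, α m j = β m j) : S.IsSeam α n = S.IsSeam β n := by
  funext p
  simp only [IsSeam, phase_eq_of_forall h,
    cyclicWord_eq_of_forall fun m hm => h m (Nat.lt_succ_of_lt hm)]

/-- Encodes the small subsets of `t` by maps from `Fin K`, padded with an arbitrary element. A union
bound over them then has `t.card ^ K` terms. -/
theorem _root_.Finset.exists_fin_image_superset {T : Type*} [DecidableEq T] {s t : Finset T}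
    (hs : s ⊆ t) (ht : t.Nonempty) {K : ℕ} (hK : s.card ≤ K) :
    ∃ f ∈ Fintype.piFinset (fun _ : Fin K => t), s ⊆ Finset.univ.image f := by
  obtain ⟨x₀, hx₀⟩ := ht
  refine ⟨fun i => if h : i.1 < s.card then (s.equivFin.symm ⟨i, h⟩).1 else x₀, ?_, ?_⟩
  · rw [Fintype.mem_piFinset]
    intro i
    split_ifs
    · exact hs (Subtype.prop _)
    · exact hx₀
  · intro x hx
    refine Finset.mem_image.2 ⟨⟨(s.equivFin ⟨x, hx⟩).1, (Fin.is_lt _).trans_le hK⟩,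
      Finset.mem_univ _, ?_⟩
    simp

variable {Ω : Type*} [MeasurableSpace Ω] {P : Measure Ω} [IsProbabilityMeasure P]
  {ω : ℕ → ℕ → Ω → ℕ}

/-- If few pairs of phases occur, some set of at most `K` pairs contains them all. For a fixed such
set, each of the `N` junctions independently fails to be a new seam; the factor h ^ (2K) counts the
candidate sets. -/
theorem measure_card_seamPhases_le
    (hzero : ∀ n x, ω n 0 x = 0)
    (hmeas : ∀ n j, 1 ≤ j → j < S.q n → Measurable (ω n j))
    (hunif : ∀ n j, 1 ≤ j → j < S.q n → P.map (ω n j) = uniformOn (Set.Iio (S.height n)))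
    (hindep : iIndepFun
      (fun (p : {p : ℕ × ℕ // 1 ≤ p.2 ∧ p.2 < S.q p.1}) => ω p.1.1 p.1.2) P)
    (n N K : ℕ) (hq : 12 ≤ S.q n) (hN : 2 * N < S.q (n + 2))
    (hK : 48 * S.height 0 * K ≤ S.height (n + 1) ^ 2) :
    P {x | (S.seamPhases (fun m j => ω m j x) (n + 1) N).card ≤ K} ≤
      ENNReal.ofReal ((S.height (n + 1) : ℝ) ^ (2 * K) *
        (1 - 1 / (48 * S.height 0 : ℝ)) ^ N) := by
  classical
  set h := S.height (n + 1) with hh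
  set t := Finset.range h ×ˢ Finset.range h with ht
  have hc0 : (0 : ℝ) ≤ 1 - 1 / (48 * S.height 0 : ℝ) := by
    have : (1 : ℝ) ≤ S.height 0 := by exact_mod_cast S.height_pos 0
    rw [sub_nonneg, div_le_one (by linarith)]
    linarith
  let bad : (Fin K → ℕ × ℕ) → Set Ω := fun f =>
    {x | ∀ k ∈ Finset.range N, (ω (n + 2) (2 * k + 1) x, ω (n + 2) (2 * k + 2) x) ∈
      {p : ℕ × ℕ | S.IsSeam (fun m j => ω m j x) (n + 1) p →
        (S.phase (fun m j => ω m j x) (n + 1) p.1, S.phase (fun m j => ω m j x) (n + 1) p.2) ∈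
          Finset.univ.image f}}
  have hsub : {x | (S.seamPhases (fun m j => ω m j x) (n + 1) N).card ≤ K} ⊆
      ⋃ f ∈ Fintype.piFinset (fun _ : Fin K => t), bad f := by
    intro x hx
    have hst : S.seamPhases (fun m j => ω m j x) (n + 1) N ⊆ t := by
      intro p hp
      obtain ⟨k, -, rfl⟩ := Finset.mem_image.1 hp
      simp [ht, hh, phase_lt]
    obtain ⟨f, hf, hfx⟩ := Finset.exists_fin_image_superset hst
      ⟨(0, 0), by simp [ht, hh, S.height_pos]⟩ hx
    simp only [Set.mem_iUnion]
    refine ⟨f, hf, fun k hk hs => hfx ?_⟩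
    exact Finset.mem_image.2 ⟨k, Finset.mem_filter.2 ⟨hk, hs⟩, rfl⟩
  have hbad : ∀ f ∈ Fintype.piFinset (fun _ : Fin K => t), P (bad f) ≤
      ENNReal.ofReal ((1 - 1 / (48 * S.height 0 : ℝ)) ^ N) := by
    intro f _
    have hF : 48 * S.height 0 * (Finset.univ.image f).card ≤ S.height (n + 1) ^ 2 := by
      refine le_trans (Nat.mul_le_mul_left _ ?_) hK
      exact Finset.card_image_le.trans (by simp)
    -- The junctions between copies 2k + 1 and 2k + 2 involve disjoint pairs of parameters and avoid
    -- the unrotated copy 0.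
    have := S.measure_forall_pair_mem_le hzero hmeas hunif hindep (n + 2) (Finset.range N)
      (a := fun k => 2 * k + 1) (b := fun k => 2 * k + 2)
      (fun k hk => by rw [Finset.mem_range] at hk; omega)
      (fun k hk => by rw [Finset.mem_range] at hk; omega)
      (fun k _ l _ hkl => by simpa using hkl) (fun k _ l _ hkl => by simpa using hkl)
      (fun k _ l _ => by omega)
      (fun α _ => {p : ℕ × ℕ | S.IsSeam α (n + 1) p →
        (S.phase α (n + 1) p.1, S.phase α (n + 1) p.2) ∈ Finset.univ.image f})
      (fun α β hαβ => by rw [isSeam_eq_of_forall hαβ, phase_eq_of_forall hαβ]) hc0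
      (fun α k _ => by
        convert card_not_new_seam_le (S := S) α n hq _ hF using 4
        exact Iff.rfl)
    rwa [Finset.card_range] at this
  refine (measure_mono hsub).trans ((measure_biUnion_finset_le _ _).trans ?_)
  refine (Finset.sum_le_sum hbad).trans (le_of_eq ?_)
  rw [Finset.sum_const, Fintype.card_piFinset, Finset.prod_const, Finset.card_univ,
    Fintype.card_fin, ht, Finset.card_product, Finset.card_range, nsmul_eq_mul,
    ENNReal.ofReal_mul (by positivity), pow_mul, sq, ← Nat.cast_mul, ← Nat.cast_pow,
    ENNReal.ofReal_natCast]

end IcebergScheme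

/-! ### Subwords across a seam -/

namespace IcebergScheme

variable {A : Type*} {S : IcebergScheme A}

/-- The word of length `S.height n` made of the `t` letters of the periodic word of step `n` that
precede the position `x`, followed by the `S.height n - t` letters that start at the position
`y`. -/
def seamWord (S : IcebergScheme A) (α : ℕ → ℕ → ℕ) (n x y t : ℕ) : Fin (S.height n) → A := fun i =>
  if i.1 < t then S.cyclicWord α n (x + (S.height n - t) + i.1)
  else S.cyclicWord α n (y + (i.1 - t))

/-- The first third of the common word lies before both cuts and the last third after both, so each
determines a position of the periodic word. -/
theorem modEq_of_seamWord_eq {α : ℕ → ℕ → ℕ} {n : ℕ} (hS : S.SegmentsDeterminePosition α n)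
    {x y x' y' t t' : ℕ} (ht : S.height n / 3 ≤ t) (htt : t ≤ t')
    (ht' : t' ≤ S.height n - S.height n / 3)
    (h : S.seamWord α n x y t = S.seamWord α n x' y' t') :
    x + (t' - t) ≡ x' [MOD S.height n] ∧ y + (t' - t) ≡ y' [MOD S.height n] := by
  set l := S.height n with hl
  have hpos : 0 < l := S.height_pos n
  constructor
  · have h1 : x + (l - t) ≡ x' + (l - t') [MOD l] := by
      refine hS _ _ fun k hk => ?_
      have := congrFun h ⟨k, by omega⟩
      simpa only [seamWord, ← hl, if_pos (show k < t by omega), if_pos (show k < t' by omega)]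
        using this
    have h2 := h1.add_right t'
    rw [show x + (l - t) + t' = x + (t' - t) + l by omega,
      show x' + (l - t') + t' = x' + l by omega] at h2
    exact Nat.ModEq.add_right_cancel' l h2
  · refine hS _ _ fun k hk => ?_
    have := congrFun h ⟨t' + k, by omega⟩
    simp only [seamWord, if_neg (show ¬ t' + k < t by omega),
      if_neg (show ¬ t' + k < t' by omega)] at this
    rw [show y + (t' - t) + k = y + (t' + k - t) by omega, this]
    congr 1
    omega

/-- If t < t', the left pieces are aligned, so at index t the second word still shows the letter at
phase x, while the first already shows the letter at phase y. These differ. -/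
theorem seamWord_eq_imp_le {α : ℕ → ℕ → ℕ} {n : ℕ} (hS : S.SegmentsDeterminePosition α n)
    {x y x' y' t t' : ℕ} (hxy : S.cyclicWord α n x ≠ S.cyclicWord α n y)
    (ht : S.height n / 3 ≤ t) (ht' : t' ≤ S.height n - S.height n / 3)
    (h : S.seamWord α n x y t = S.seamWord α n x' y' t') : t' ≤ t := by
  by_contra! hlt
  have h1 := (modEq_of_seamWord_eq hS ht hlt.le ht' h).1
  set l := S.height n with hl
  have hpos : 0 < l := S.height_pos n
  have h2 := congrFun h ⟨t, by omega⟩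
  simp only [seamWord, lt_irrefl, if_false, if_pos hlt, Nat.sub_self, add_zero, ← hl] at h2
  refine hxy (Eq.trans ?_ h2.symm)
  refine cyclicWord_congr ?_
  have h3 := (h1.add_right (l - t' + t)).symm
  rw [show x + (t' - t) + (l - t' + t) = x + l by omega, ← add_assoc] at h3
  exact (h3.trans (by simp [Nat.ModEq])).symm

theorem seamWord_injOn {α : ℕ → ℕ → ℕ} {n : ℕ} (hS : S.SegmentsDeterminePosition α n) :
    Set.InjOn (fun p : (ℕ × ℕ) × ℕ => S.seamWord α n p.1.1 p.1.2 p.2)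
      {p | p.1.1 < S.height n ∧ p.1.2 < S.height n ∧
        S.cyclicWord α n p.1.1 ≠ S.cyclicWord α n p.1.2 ∧
        S.height n / 3 ≤ p.2 ∧ p.2 ≤ S.height n - S.height n / 3} := by
  rintro ⟨⟨x, y⟩, t⟩ ⟨hx, hy, hxy, ht1, ht2⟩ ⟨⟨x', y'⟩, t'⟩ ⟨hx', hy', hxy', ht1', ht2'⟩ h
  have h1 : t' ≤ t := seamWord_eq_imp_le hS hxy ht1 ht2' h
  have h2 : t ≤ t' := seamWord_eq_imp_le hS hxy' ht1' ht2 h.symm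
  obtain rfl : t = t' := le_antisymm h2 h1
  obtain ⟨h3, h4⟩ := modEq_of_seamWord_eq hS ht1 le_rfl ht2 h
  simp only [Nat.sub_self, add_zero] at h3 h4
  rw [Nat.ModEq.eq_of_lt_of_lt h3 hx hx', Nat.ModEq.eq_of_lt_of_lt h4 hy hy']

/-- The copy before the junction ends with `X % h` letters from a single block of step `n`, and the
one after it begins with `h - X' % h` letters from a single block. The two hypotheses on `t` say
that the window stays within these pieces. -/
theorem seamWord_mem_subwords {α : ℕ → ℕ → ℕ} (h0 : ∀ m, α m 0 = 0) {n j t : ℕ}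
    (hj : j + 1 < S.q (n + 1)) (htX : t ≤ α (n + 1) j % S.height n)
    (htX' : α (n + 1) (j + 1) % S.height n ≤ t) :
    S.seamWord α n (S.phase α n (α (n + 1) j)) (S.phase α n (α (n + 1) (j + 1))) t ∈
      subwords (S.limitWord α) (S.height n) := by
  set X := α (n + 1) j with hX
  set X' := α (n + 1) (j + 1) with hX'
  set h := S.height n with hh
  set H := S.height (n + 1) with hH
  have hpos : 0 < h := S.height_pos n
  have hhH : h ≤ H := Nat.le_mul_of_pos_left _ (S.q_pos n)
  have hth : t < h := htX.trans_lt (Nat.mod_lt _ hpos)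
  have hjH : (j + 1 + 1) * H ≤ S.height (n + 2) := Nat.mul_le_mul_right _ hj
  have e1 : (j + 1) * H = j * H + H := by ring
  have e2 : (j + 1 + 1) * H = j * H + H + H := by ring
  have hX1 := Nat.div_add_mod X h
  have hX1' := Nat.div_add_mod X' h
  rw [mul_comm] at hX1 hX1'
  have hX2 : X % h < h := Nat.mod_lt _ hpos
  -- The subword starts `t` letters before the junction of copies `j` and `j + 1`.
  refine ⟨(j + 1) * H - t, fun ⟨i, hi⟩ => ?_⟩
  simp only
  rw [limitWord_eq_cyclicWord h0 (n := n + 2) (by omega)]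
  by_cases hit : i < t
  · rw [seamWord, if_pos hit,
      show (j + 1) * H - t + i = j * H + (H - t + i) by omega,
      cyclicWord_succ_block _ _ _ _ (by omega), Nat.mod_eq_of_lt (by omega), ← hX,
      cyclicWord_congr (n := n + 1) (i := H - t + i + X) (j := X / h * h + (X % h - t + i)),
      cyclicWord_succ_block _ _ _ _ (by omega)]
    · refine cyclicWord_congr ?_
      refine Nat.ModEq.add_right_cancel' t ?_
      show S.phase α n X + (h - t) + i + t ≡ _ [MOD h]
      rw [show S.phase α n X + (h - t) + i + t = S.phase α n X + i + h by omega,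
        show X % h - t + i + α n (X / h % S.q n) + t = X % h + α n (X / h % S.q n) + i by omega]
      have hp : S.phase α n X ≡ X % h + α n (X / h % S.q n) [MOD h] :=
        (Nat.mod_modEq _ _).trans ((Nat.mod_modEq X h).symm.add_right _)
      exact (show _ ≡ S.phase α n X + i [MOD h] by simp [Nat.ModEq]).trans (hp.add_right _)
    · rw [show H - t + i + X = X / h * h + (X % h - t + i) + H by omega]
      simp [Nat.ModEq, hH]
  · rw [seamWord, if_neg hit,
      show (j + 1) * H - t + i = (j + 1) * H + (i - t) by omega,
      cyclicWord_succ_block _ _ _ _ (by omega), Nat.mod_eq_of_lt hj, ← hX',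
      show i - t + X' = X' / h * h + (X' % h + (i - t)) by omega,
      cyclicWord_succ_block _ _ _ _ (by omega)]
    refine cyclicWord_congr ?_
    have hp : S.phase α n X' ≡ X' % h + α n (X' / h % S.q n) [MOD h] :=
      (Nat.mod_modEq _ _).trans ((Nat.mod_modEq X' h).symm.add_right _)
    rw [show X' % h + (i - t) + α n (X' / h % S.q n) =
      X' % h + α n (X' / h % S.q n) + (i - t) by omega]
    exact hp.add_right _

/-- Every pair of phases of a visible seam yields `S.height n / 3` subwords of its own. -/
theorem card_seamPhases_mul_le [Finite A] {α : ℕ → ℕ → ℕ} (h0 : ∀ m, α m 0 = 0) {n N : ℕ}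
    (hN : 2 * N < S.q (n + 1)) (hS : S.SegmentsDeterminePosition α n) :
    (S.seamPhases α n N).card * (S.height n / 3) ≤
      symbolicComplexity (S.limitWord α) (S.height n) := by
  classical
  set h := S.height n with hh
  set T := S.seamPhases α n N ×ˢ Finset.Icc (h / 3) (h - h / 3) with hT
  have hTmem : ∀ p ∈ T, ∃ k < N, S.IsSeam α n (α (n + 1) (2 * k + 1), α (n + 1) (2 * k + 2)) ∧
      p.1 = (S.phase α n (α (n + 1) (2 * k + 1)), S.phase α n (α (n + 1) (2 * k + 2))) ∧
      h / 3 ≤ p.2 ∧ p.2 ≤ h - h / 3 := by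
    intro p hp
    obtain ⟨hp1, hp2⟩ := Finset.mem_product.1 hp
    obtain ⟨k, hk, hkp⟩ := Finset.mem_image.1 hp1
    obtain ⟨hkN, hks⟩ := Finset.mem_filter.1 hk
    exact ⟨k, Finset.mem_range.1 hkN, hks, hkp.symm, Finset.mem_Icc.1 hp2⟩
  have hinj : Set.InjOn (fun p : (ℕ × ℕ) × ℕ => S.seamWord α n p.1.1 p.1.2 p.2) T := by
    refine (seamWord_injOn hS).mono fun p hp => ?_
    obtain ⟨k, -, hks, hkp, hp2⟩ := hTmem p hp
    refine ⟨?_, ?_, ?_, hp2⟩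
    · rw [hkp]; exact phase_lt _ _ _
    · rw [hkp]; exact phase_lt _ _ _
    · rw [hkp]; exact hks.2.2
  have hsub : ((T.image fun p : (ℕ × ℕ) × ℕ => S.seamWord α n p.1.1 p.1.2 p.2 :
      Finset (Fin h → A)) : Set (Fin h → A)) ⊆ subwords (S.limitWord α) h := by
    intro u hu
    obtain ⟨p, hp, rfl⟩ := Finset.mem_image.1 (Finset.mem_coe.1 hu)
    obtain ⟨k, hkN, hks, hkp, hp1, hp2⟩ := hTmem p hp
    obtain ⟨hs1, hs2, -⟩ := hks
    simp only [← hh] at hs1 hs2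
    rw [hkp]
    exact seamWord_mem_subwords (j := 2 * k + 1) h0 (by omega) (hp2.trans hs1) (hs2.le.trans hp1)
  have hcard := Set.ncard_le_ncard hsub (Set.toFinite _)
  rw [Set.ncard_coe_finset, Finset.card_image_of_injOn hinj, hT, Finset.card_product,
    Nat.card_Icc] at hcard
  refine le_trans (Nat.mul_le_mul_left _ ?_) hcard
  omega

end IcebergScheme

/-! ### Asymptotic estimates and Borel–Cantelli -/

theorem eventually_pow_mul_pow_div_le_one {c : ℝ} (hc0 : 0 ≤ c) (hc1 : c < 1) (C : ℝ) (d : ℕ) :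
    ∀ᶠ q : ℕ in atTop, C * (q : ℝ) ^ d * c ^ (q / 9 - 1) ≤ 1 := by
  have h1 : Tendsto (fun n : ℕ => |C| * 26 ^ d * ((n : ℝ) ^ d * c ^ n)) atTop (nhds 0) := by
    simpa using (tendsto_pow_const_mul_const_pow_of_abs_lt_one d
      (by rwa [abs_of_nonneg hc0])).const_mul (|C| * 26 ^ d)
  have h2 : Tendsto (fun q : ℕ => q / 9 - 1) atTop atTop :=
    tendsto_atTop_atTop.2 fun b => ⟨9 * (b + 1), fun a ha => by omega⟩
  filter_upwards [(h1.comp h2).eventually_le_const one_pos, eventually_ge_atTop 18] with q hq hq18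
  refine le_trans ?_ hq
  have h3 : (q : ℝ) ≤ 26 * ((q / 9 - 1 : ℕ) : ℝ) := by
    exact_mod_cast (show q ≤ 26 * (q / 9 - 1) by omega)
  calc C * (q : ℝ) ^ d * c ^ (q / 9 - 1)
      ≤ |C| * (26 * ((q / 9 - 1 : ℕ) : ℝ)) ^ d * c ^ (q / 9 - 1) := by
        gcongr
        exact le_abs_self C
    _ = _ := by simp only [Function.comp]; rw [mul_pow]; ring

/-- The logarithmic form of x ^ (2K + 2) c ^ N ≤ 1 for K = x ^ (2 - ε), N = x ^ 2 / 8 - 1 and r =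
-log c: the factor x ^ ε beats the logarithm. -/
theorem eventually_rpow_mul_log_add_le {ε r : ℝ} (hε : 0 < ε) (hr : 0 < r) :
    ∀ᶠ x : ℝ in atTop, (2 * x ^ (2 - ε) + 2) * Real.log x ≤ (x ^ 2 / 8 - 1) * r := by
  have h1 := (isLittleO_log_rpow_atTop hε).def (show 0 < r / 64 by positivity)
  have h2 := (isLittleO_log_rpow_atTop (show (0 : ℝ) < 2 by norm_num)).def
    (show 0 < r / 64 by positivity)
  filter_upwards [h1, h2, eventually_ge_atTop 4] with x h1 h2 hx
  have hx0 : 0 < x := by linarith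
  rw [Real.norm_of_nonneg (Real.log_nonneg (by linarith)),
    Real.norm_of_nonneg (by positivity)] at h1 h2
  rw [Real.rpow_two] at h2
  have h3 : x ^ (2 - ε) * Real.log x ≤ r / 64 * x ^ 2 := by
    calc x ^ (2 - ε) * Real.log x ≤ x ^ (2 - ε) * (r / 64 * x ^ ε) := by gcongr
      _ = r / 64 * (x ^ (2 - ε) * x ^ ε) := by ring
      _ = r / 64 * x ^ 2 := by rw [← Real.rpow_add hx0, sub_add_cancel, Real.rpow_two]
  have h4 : r * 4 ^ 2 ≤ r * x ^ 2 := by gcongr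
  calc (2 * x ^ (2 - ε) + 2) * Real.log x = 2 * (x ^ (2 - ε) * Real.log x) + 2 * Real.log x := by
        ring
    _ ≤ (x ^ 2 / 8 - 1) * r := by linarith

namespace IcebergScheme

variable {A : Type*} {S : IcebergScheme A}

/-- The only consequence of the growth condition that the proof needs. -/
theorem eventually_height_le_two_mul_q {γ : ℝ} (hγ : 1 ≤ γ)
    (hq : (fun n => (S.q n : ℝ)) ~[atTop] (fun n => (S.height n : ℝ) ^ γ)) :
    ∀ᶠ n in atTop, S.height n ≤ 2 * S.q n := by
  have h1 := hq.isLittleO.def (show (0 : ℝ) < 1 / 2 by norm_num)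
  filter_upwards [h1] with n hn
  have hh : (1 : ℝ) ≤ S.height n := by exact_mod_cast S.height_pos n
  rw [Pi.sub_apply, Real.norm_of_nonneg (r := (S.height n : ℝ) ^ γ) (by positivity),
    Real.norm_eq_abs, abs_le] at hn
  have h2 : (S.height n : ℝ) ≤ (S.height n : ℝ) ^ γ := Real.self_le_rpow_of_one_le hh hγ
  have h3 : (S.height n : ℝ) ≤ 2 * S.q n := by linarith [hn.1]
  exact_mod_cast h3

theorem tendsto_height_atTop : Tendsto S.height atTop atTop :=
  tendsto_atTop_mono (fun n => (S.lt_height n).le) tendsto_id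

theorem tendsto_q_atTop (hq : ∀ᶠ n in atTop, S.height n ≤ 2 * S.q n) :
    Tendsto S.q atTop atTop := by
  refine tendsto_atTop.2 fun b => ?_
  filter_upwards [hq, eventually_ge_atTop (2 * b)] with n hn hb
  have := S.lt_height n
  omega

theorem tsum_measure_ne_top_of_eventually_le {Ω : Type*} [MeasurableSpace Ω] {P : Measure Ω}
    [IsFiniteMeasure P] {s : ℕ → Set Ω} {C : ℝ}
    (h : ∀ᶠ n in atTop, P (s n) ≤ ENNReal.ofReal (C / (n : ℝ) ^ 2)) : ∑' n, P (s n) ≠ ⊤ := by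
  have hsum : Summable fun n => P.real (s n) := by
    have h2 : Summable fun n : ℕ => |C| / (n : ℝ) ^ 2 := by
      simpa only [div_eq_mul_inv] using (Real.summable_nat_pow_inv.2 one_lt_two).mul_left |C|
    refine Summable.of_norm_bounded_eventually_nat h2 ?_
    filter_upwards [h] with n hn
    rw [Real.norm_of_nonneg measureReal_nonneg]
    refine ENNReal.toReal_le_of_le_ofReal (by positivity) (hn.trans ?_)
    gcongr
    exact le_abs_self C
  have := hsum.tsum_ofReal_ne_top
  have heq : ∀ n, ENNReal.ofReal (P.real (s n)) = P (s n) := fun n => ofReal_measureReal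
  simpa only [heq] using this

variable {Ω : Type*} [MeasurableSpace Ω] {P : Measure Ω} [IsProbabilityMeasure P]
  {ω : ℕ → ℕ → Ω → ℕ}

/-- Here `S.height (n + 1)` is at most 2q ^ 2 and n at most 2q for q = `S.q n`, so a power of q
competes with an exponential in q. -/
theorem ae_eventually_segmentsDeterminePosition
    (hq : ∀ᶠ n in atTop, S.height n ≤ 2 * S.q n)
    (hzero : ∀ n x, ω n 0 x = 0)
    (hmeas : ∀ n j, 1 ≤ j → j < S.q n → Measurable (ω n j))
    (hunif : ∀ n j, 1 ≤ j → j < S.q n → P.map (ω n j) = uniformOn (Set.Iio (S.height n)))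
    (hindep : iIndepFun
      (fun (p : {p : ℕ × ℕ // 1 ≤ p.2 ∧ p.2 < S.q p.1}) => ω p.1.1 p.1.2) P) :
    ∀ᵐ x ∂P, ∀ᶠ n in atTop,
      S.SegmentsDeterminePosition (fun m j => ω m j x) (n + 1) := by
  have hsum : ∑' n, P {x | ¬ S.SegmentsDeterminePosition (fun m j => ω m j x) (n + 1)} ≠ ⊤ := by
    refine tsum_measure_ne_top_of_eventually_le (C := 4) ?_
    filter_upwards [hq, (tendsto_q_atTop hq).eventually (eventually_pow_mul_pow_div_le_one
      (one_sub_inv_height_nonneg (S := S)) one_sub_inv_height_lt_one 4 6),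
      eventually_gt_atTop 0] with n hn hqn hn0
    refine (measure_not_segmentsDeterminePosition_le hzero hmeas hunif hindep n).trans
      (ENNReal.ofReal_le_ofReal ?_)
    set c := 1 - 1 / (S.height 0 : ℝ) with hc
    have hn' : (n : ℝ) ≤ 2 * S.q n := by exact_mod_cast (S.lt_height n).le.trans hn
    have hn0' : (0 : ℝ) < n := by exact_mod_cast hn0
    have hH : (S.height (n + 1) : ℝ) ≤ 2 * (S.q n : ℝ) ^ 2 := by
      have : S.height (n + 1) ≤ 2 * S.q n ^ 2 := by
        rw [height_succ]
        calc S.q n * S.height n ≤ S.q n * (2 * S.q n) := Nat.mul_le_mul_left _ hn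
          _ = _ := by ring
      exact_mod_cast this
    have hc0 : 0 ≤ c := one_sub_inv_height_nonneg
    rw [le_div_iff₀ (by positivity)]
    calc (S.height (n + 1) : ℝ) ^ 2 * c ^ (S.q n / 9 - 1) * (n : ℝ) ^ 2
        ≤ (2 * (S.q n : ℝ) ^ 2) ^ 2 * c ^ (S.q n / 9 - 1) * (2 * S.q n) ^ 2 := by gcongr
      _ = 4 * (4 * (S.q n : ℝ) ^ 6 * c ^ (S.q n / 9 - 1)) := by ring
      _ ≤ 4 := by linarith
  filter_upwards [ae_eventually_notMem hsum] with x hx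
  filter_upwards [hx] with n hn
  exact not_not.1 hn

theorem ae_eventually_card_seamPhases_gt
    (hq : ∀ᶠ n in atTop, S.height n ≤ 2 * S.q n)
    (hzero : ∀ n x, ω n 0 x = 0)
    (hmeas : ∀ n j, 1 ≤ j → j < S.q n → Measurable (ω n j))
    (hunif : ∀ n j, 1 ≤ j → j < S.q n → P.map (ω n j) = uniformOn (Set.Iio (S.height n)))
    (hindep : iIndepFun
      (fun (p : {p : ℕ × ℕ // 1 ≤ p.2 ∧ p.2 < S.q p.1}) => ω p.1.1 p.1.2) P)
    {ε : ℝ} (hε : 0 < ε) :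
    ∀ᵐ x ∂P, ∀ᶠ n in atTop, (S.height (n + 1) : ℝ) ^ (2 - ε) <
      (S.seamPhases (fun m j => ω m j x) (n + 1) ((S.q (n + 2) - 1) / 2)).card := by
  set c := 1 - 1 / (48 * S.height 0 : ℝ) with hc
  have h0 : (1 : ℝ) ≤ S.height 0 := by exact_mod_cast S.height_pos 0
  have hc0 : 0 < c := by
    rw [hc, sub_pos, div_lt_one (by linarith)]
    linarith
  have hc1 : c < 1 := by
    have : 0 < 1 / (48 * S.height 0 : ℝ) := by positivity
    linarith
  have hlog : Real.log c < 0 := Real.log_neg hc0 hc1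
  have hheight : Tendsto (fun n => (S.height (n + 1) : ℝ)) atTop atTop :=
    tendsto_natCast_atTop_atTop.comp (tendsto_height_atTop.comp (tendsto_add_atTop_nat 1))
  have hsum : ∑' n, P {x | (S.seamPhases (fun m j => ω m j x) (n + 1)
      ((S.q (n + 2) - 1) / 2)).card ≤ ⌊(S.height (n + 1) : ℝ) ^ (2 - ε)⌋₊} ≠ ⊤ := by
    refine tsum_measure_ne_top_of_eventually_le (C := 1) ?_
    filter_upwards [(tendsto_add_atTop_nat 1).eventually hq,
      (tendsto_add_atTop_nat 2).eventually hq,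
      (tendsto_q_atTop hq).eventually_ge_atTop 12,
      hheight.eventually (eventually_rpow_mul_log_add_le hε (neg_pos.2 hlog)),
      hheight.eventually ((tendsto_rpow_atTop hε).eventually_ge_atTop (48 * S.height 0 : ℝ)),
      eventually_gt_atTop 0] with n hn1 hn2 hq12 hlogn hpow hn0
    set h := S.height (n + 1) with hh
    set K := ⌊(h : ℝ) ^ (2 - ε)⌋₊ with hK
    set N := (S.q (n + 2) - 1) / 2 with hN
    have hhpos : (0 : ℝ) < h := by exact_mod_cast S.height_pos (n + 1)
    have hKle : (K : ℝ) ≤ (h : ℝ) ^ (2 - ε) := Nat.floor_le (by positivity)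
    have hKh : 48 * S.height 0 * K ≤ h ^ 2 := by
      have : (48 * S.height 0 * K : ℝ) ≤ (h : ℝ) ^ 2 := by
        calc (48 * S.height 0 * K : ℝ) ≤ (h : ℝ) ^ ε * (h : ℝ) ^ (2 - ε) := by gcongr
          _ = (h : ℝ) ^ 2 := by
            rw [← Real.rpow_add hhpos, add_sub_cancel, Real.rpow_two]
      exact_mod_cast this
    have hq2 := S.two_le_q (n + 2)
    refine (measure_card_seamPhases_le hzero hmeas hunif hindep n N K hq12 (by omega) hKh).trans
      (ENNReal.ofReal_le_ofReal ?_)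
    -- The growth condition is used at two consecutive steps: `S.height (n + 2)` ≥ h ^ 2 / 2, then
    -- `S.q (n + 2)` ≥ h ^ 2 / 4, and pairing the copies halves this again.
    have hNh : (h : ℝ) ^ 2 / 8 - 1 ≤ N := by
      have h1 : S.height (n + 2) ≤ 2 * (2 * N + 2) := by
        refine le_trans hn2 ?_
        show 2 * S.q (n + 2) ≤ _
        omega
      have h2 : h * h ≤ 2 * S.height (n + 2) := by
        calc h * h ≤ 2 * S.q (n + 1) * h := Nat.mul_le_mul_right _ hn1
          _ = 2 * S.height (n + 2) := by rw [height_succ S (n + 1)]; ring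
      have h3 : h * h ≤ 8 * N + 8 := by omega
      rify at h3
      nlinarith
    have hnh : (n : ℝ) ≤ h := by
      exact_mod_cast n.le_succ.trans (S.lt_height (n + 1)).le
    have hn0' : (0 : ℝ) < n := by exact_mod_cast hn0
    rw [le_div_iff₀ (by positivity)]
    calc (h : ℝ) ^ (2 * K) * c ^ N * (n : ℝ) ^ 2 ≤ (h : ℝ) ^ (2 * K) * c ^ N * (h : ℝ) ^ 2 := by
          gcongr
      _ = Real.exp ((2 * K + 2) * Real.log h + N * Real.log c) := by
          rw [Real.exp_add, add_mul, Real.exp_add]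
          have e1 : Real.exp (2 * K * Real.log h) = (h : ℝ) ^ (2 * K) := by
            rw [← Real.exp_log hhpos, ← Real.exp_nat_mul, Real.exp_log hhpos]; push_cast; rfl
          have e2 : Real.exp (2 * Real.log h) = (h : ℝ) ^ 2 := by
            rw [← Real.exp_log hhpos, ← Real.exp_nat_mul, Real.exp_log hhpos]; push_cast; rfl
          have e3 : Real.exp (N * Real.log c) = c ^ N := by
            rw [Real.exp_nat_mul, Real.exp_log hc0]
          rw [e1, e2, e3]; ring
      _ ≤ 1 := by
          rw [Real.exp_le_one_iff]
          have hlogh : 0 ≤ Real.log h := Real.log_nonneg (by exact_mod_cast S.height_pos (n + 1))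
          have h4 : (2 * K + 2) * Real.log h ≤ (2 * (h : ℝ) ^ (2 - ε) + 2) * Real.log h := by
            gcongr
          have h5 : ((h : ℝ) ^ 2 / 8 - 1) * -Real.log c ≤ N * -Real.log c :=
            mul_le_mul_of_nonneg_right hNh (neg_pos.2 hlog).le
          linarith
  filter_upwards [ae_eventually_notMem hsum] with x hx
  filter_upwards [hx] with n hn
  exact (Nat.floor_lt (by positivity)).1 (not_le.1 hn)

end IcebergScheme

/-! ### The almost sure lower bound -/

theorem theorem4 {A : Type*} [Finite A] (S : IcebergScheme A) (γ : ℝ) (hγ : 1 ≤ γ)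
    (hq : (fun n => (S.q n : ℝ)) ~[atTop] (fun n => (S.height n : ℝ) ^ γ))
    {Ω : Type*} [MeasurableSpace Ω] (P : Measure Ω) [IsProbabilityMeasure P]
    (ω : ℕ → ℕ → Ω → ℕ)
    (hzero : ∀ n x, ω n 0 x = 0)
    (hmeas : ∀ n j, 1 ≤ j → j < S.q n → Measurable (ω n j))
    (hunif : ∀ n j, 1 ≤ j → j < S.q n →
      P.map (ω n j) = uniformOn (Set.Iio (S.height n)))
    (hindep : iIndepFun
      (fun (p : {p : ℕ × ℕ // 1 ≤ p.2 ∧ p.2 < S.q p.1}) => ω p.1.1 p.1.2) P) :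
    ∀ᵐ x ∂P, ∀ ε : ℝ, 0 < ε → ∃ n₀ : ℕ, ∀ n, n₀ ≤ n →
      (S.height n : ℝ) ^ (3 - ε) ≤
        (symbolicComplexity (S.limitWord (fun m j => ω m j x)) (S.height n) : ℝ) := by
  have hq' := IcebergScheme.eventually_height_le_two_mul_q hγ hq
  -- Countably many exponents suffice for a null set independent of ε.
  have hseams : ∀ᵐ x ∂P, ∀ k : ℕ, ∀ᶠ n in atTop,
      (S.height (n + 1) : ℝ) ^ (2 - 1 / ((k : ℝ) + 1)) <
        (S.seamPhases (fun m j => ω m j x) (n + 1) ((S.q (n + 2) - 1) / 2)).card :=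
    ae_all_iff.2 fun k => IcebergScheme.ae_eventually_card_seamPhases_gt hq' hzero hmeas hunif
      hindep Nat.one_div_pos_of_nat
  filter_upwards [hseams, IcebergScheme.ae_eventually_segmentsDeterminePosition hq' hzero hmeas
    hunif hindep] with x hx hdet ε hε
  -- Half of ε is lost in the number of pairs of phases; the other half absorbs the constant 4 in h
  -- / 3 ≥ h / 4, which allows for rounding.
  obtain ⟨k, hk⟩ := exists_nat_one_div_lt (half_pos hε)
  set δ : ℝ := 1 / ((k : ℝ) + 1) with hδ
  have hδ0 : 0 < δ := Nat.one_div_pos_of_nat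
  have hheight : Tendsto (fun n => (S.height (n + 1) : ℝ)) atTop atTop :=
    tendsto_natCast_atTop_atTop.comp
      (IcebergScheme.tendsto_height_atTop.comp (tendsto_add_atTop_nat 1))
  obtain ⟨n₁, hn₁⟩ := eventually_atTop.1 ((hx k).and (hdet.and
    ((hheight.eventually ((tendsto_rpow_atTop hδ0).eventually_ge_atTop 4)).and
      (hheight.eventually_ge_atTop 12))))
  refine ⟨n₁ + 1, fun n hn => ?_⟩
  obtain ⟨n, rfl⟩ : ∃ m, n = m + 1 := ⟨n - 1, by omega⟩
  obtain ⟨hcard, hS, hpow, h12⟩ := hn₁ n (by omega)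
  set h := S.height (n + 1) with hh
  have hhpos : (0 : ℝ) < h := by linarith
  have hmain := IcebergScheme.card_seamPhases_mul_le (S := S) (α := fun m j => ω m j x)
    (fun m => hzero m x) (n := n + 1) (N := (S.q (n + 2) - 1) / 2)
    (by have := S.two_le_q (n + 2); show 2 * ((S.q (n + 2) - 1) / 2) < S.q (n + 2); omega) hS
  have h3 : (h : ℝ) / 4 ≤ ((h / 3 : ℕ) : ℝ) := by
    have : h ≤ 4 * (h / 3) := by
      have : 12 ≤ h := by exact_mod_cast h12
      omega
    have : (h : ℝ) ≤ 4 * ((h / 3 : ℕ) : ℝ) := by exact_mod_cast this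
    linarith
  calc (h : ℝ) ^ (3 - ε) ≤ (h : ℝ) ^ (3 - 2 * δ) :=
        Real.rpow_le_rpow_of_exponent_le (by linarith) (by linarith)
    _ = (h : ℝ) ^ (2 - δ) * (h / (h : ℝ) ^ δ) := by
        rw [show 3 - 2 * δ = (2 - δ) + (1 - δ) by ring, Real.rpow_add hhpos,
          Real.rpow_sub hhpos 1, Real.rpow_one]
    _ ≤ (h : ℝ) ^ (2 - δ) * (h / 4) := by gcongr
    _ ≤ (S.seamPhases (fun m j => ω m j x) (n + 1) ((S.q (n + 2) - 1) / 2)).card *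
          ((h / 3 : ℕ) : ℝ) := by gcongr
    _ ≤ _ := by exact_mod_cast hmain
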